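/- Let $d \in \{1, 2, \dots\}$, $\alpha \in (0,2)$ and $1 \le p < \infty$. For $t > 0$ let $p_t$ be the function on $\mathbf{R}^d$ whose Fourier transform $\int_{\mathbf{R}^d} e^{-i \xi \cdot z} p_t(z)\, dz$ equals $e^{-t|\xi|^\alpha}$, that is, $p_t(z) = (2\pi)^{-d} \int_{\mathbf{R}^d} e^{i \xi \cdot z} e^{-t|\xi|^\alpha}\, d\xi$, and let $P_t f(x) = f * p_t(x) = \int_{\mathbf{R}^d} f(x - z)\, p_t(z)\, dz$. For a (real- or complex-valued) function $f$ on $\mathbf{R}^d$ write $f \in \mathscr{D}(L_S, x)$ if the integrals $P_t f(x)$, $t > 0$, converge absolutely and the limit $$ \lim_{t \to 0^+} \frac{P_t f(x) - f(x)}{t} $$ exists (and is finite), and write $f \in \mathscr{D}(L_S, L^p)$ if $f \in L^p(\mathbf{R}^d)$ and $\frac{1}{t}(P_t f - f)$ converges in the norm of $L^p(\mathbf{R}^d)$ as $t \to 0^+$. If $f \in \mathscr{D}(L_S, L^p)$, then $f \in \mathscr{D}(L_S, x)$ for almost every $x \in \mathbf{R}^d$, and the pointwise limit $\lim_{t \to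 0^+} \frac{1}{t}(P_t f(x) - f(x))$ is equal, for almost every $x$, to the value at $x$ of the $L^p$ limit of $\frac{1}{t}(P_t f - f)$. -/

import Mathlib

open MeasureTheory Filter Topology
open scoped ENNReal FourierTransform

noncomputable section

namespace FracLaplacian

/-- The kernel `p_t` of the semigroup `P_t` on `ℝ^d`, given by `∫ e^{-i ξ · z} p_t(z) dz = e^{-t |ξ|^α}`,
that is, `p_t(z) = (2π)^{-d} ∫ e^{i ξ · z} e^{-t |ξ|^α} dξ`. The `2π` in the exponent comes from
Mathlib's normalization `𝓕⁻ g z = ∫ e^{2πi ξ · z} g(ξ) dξ`. The integral is real because the symbol is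
real and even (see `stableKernel_eq`), so the real part only changes the codomain. -/
def stableKernel (d : ℕ) (α t : ℝ) (z : EuclideanSpace ℝ (Fin d)) : ℝ :=
  (𝓕⁻ (fun ξ : EuclideanSpace ℝ (Fin d) =>
    (Real.exp (-t * (2 * Real.pi * ‖ξ‖) ^ α) : ℂ)) z).re

/-- The kernel in the normalization `p_t(z) = (2π)^{-d} ∫ e^{i ξ · z} e^{-t |ξ|^α} dξ`. -/
theorem stableKernel_eq (d : ℕ) (α t : ℝ) (z : EuclideanSpace ℝ (Fin d)) :
    (stableKernel d α t z : ℂ) = ((2 * Real.pi) ^ d)⁻¹ *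
      ∫ ξ : EuclideanSpace ℝ (Fin d),
        Complex.exp (Complex.I * (inner ℝ ξ z : ℝ)) * (Real.exp (-t * ‖ξ‖ ^ α) : ℝ) := by
  have h1 : (stableKernel d α t z : ℂ) = 𝓕⁻ (fun ξ : EuclideanSpace ℝ (Fin d) =>
      (Real.exp (-t * (2 * Real.pi * ‖ξ‖) ^ α) : ℂ)) z := by
    rw [stableKernel, ← Complex.conj_eq_iff_re, Real.fourierInv_eq', ← integral_conj,
      ← integral_neg_eq_self]
    congr 1
    ext ξ
    simp [← Complex.exp_conj, Complex.conj_ofNat]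
  have hpi : (0 : ℝ) < 2 * Real.pi := by positivity
  rw [h1, Real.fourierInv_eq']
  have h2 := Measure.integral_comp_smul (volume : Measure (EuclideanSpace ℝ (Fin d)))
    (fun ξ => Complex.exp (Complex.I * (inner ℝ ξ z : ℝ)) * (Real.exp (-t * ‖ξ‖ ^ α) : ℝ))
    (2 * Real.pi)
  rw [finrank_euclideanSpace_fin, abs_of_pos (by positivity)] at h2
  have h3 : ∀ w : ℂ, (((2 * Real.pi : ℝ) ^ d)⁻¹ : ℝ) • w = ((2 * (Real.pi : ℂ)) ^ d)⁻¹ * w := by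
    intro w
    rw [Complex.real_smul]
    push_cast
    rfl
  rw [h3] at h2
  rw [Complex.ofReal_inv, Complex.ofReal_pow, Complex.ofReal_mul, Complex.ofReal_ofNat, ← h2]
  congr 1
  ext ξ
  rw [smul_eq_mul, norm_smul, Real.norm_of_nonneg hpi.le, real_inner_smul_left]
  congr 2
  push_cast
  ring

variable {𝕜 : Type*} [RCLike 𝕜] {d : ℕ}

/-- `P_t f (x) = (f * p_t)(x) = ∫ p_t(z) f(x - z) dz`. -/
def stableSemigroup (α t : ℝ) (f : EuclideanSpace ℝ (Fin d) → 𝕜) :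
    EuclideanSpace ℝ (Fin d) → 𝕜 :=
  convolution (stableKernel d α t) f (ContinuousLinearMap.lsmul ℝ ℝ) volume

/-- The difference quotient `(P_t f (x) - f (x)) / t`. -/
def semigroupQuotient (α t : ℝ) (f : EuclideanSpace ℝ (Fin d) → 𝕜)
    (x : EuclideanSpace ℝ (Fin d)) : 𝕜 :=
  t⁻¹ • (stableSemigroup α t f x - f x)

/-- The pointwise limit at `x` exists and equals `ℓ`: the integrals defining `P_t f (x)`, `t > 0`,
converge absolutely and `(P_t f (x) - f (x)) / t → ℓ` as `t → 0⁺`. -/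
def HasSemigroupLimitAt (α : ℝ) (f : EuclideanSpace ℝ (Fin d) → 𝕜)
    (x : EuclideanSpace ℝ (Fin d)) (ℓ : 𝕜) : Prop :=
  (∀ t : ℝ, 0 < t → ConvolutionExistsAt (stableKernel d α t) f x
    (ContinuousLinearMap.lsmul ℝ ℝ) volume) ∧
  Tendsto (fun t : ℝ => semigroupQuotient α t f x) (𝓝[>] 0) (𝓝 ℓ)

/-- `f ∈ D(L_S, x)`. -/
def MemDomainAt (α : ℝ) (f : EuclideanSpace ℝ (Fin d) → 𝕜)
    (x : EuclideanSpace ℝ (Fin d)) : Prop :=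
  ∃ ℓ : 𝕜, HasSemigroupLimitAt α f x ℓ

/-- `f ∈ L^p`, `g ∈ L^p`, and `(P_t f - f) / t → g` in `L^p` as `t → 0⁺`. -/
def HasSemigroupLimitLp (α : ℝ) (p : ℝ≥0∞) (f g : EuclideanSpace ℝ (Fin d) → 𝕜) : Prop :=
  MemLp f p volume ∧ MemLp g p volume ∧
  Tendsto (fun t : ℝ => eLpNorm (semigroupQuotient α t f - g) p volume) (𝓝[>] 0) (𝓝 0)

/-- `f ∈ D(L_S, L^p)`. -/
def MemDomainLp (α : ℝ) (p : ℝ≥0∞) (f : EuclideanSpace ℝ (Fin d) → 𝕜) : Prop :=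
  ∃ g : EuclideanSpace ℝ (Fin d) → 𝕜, HasSemigroupLimitLp α p f g

end FracLaplacian

end

/-! For s > 0 the kernel p_s lies in every L^q, q ≥ 1, so Hölder's inequality turns L^p convergence
of the quotients into convergence at every point once P_s is applied. With the semigroup law, s ↦
P_s f(x) therefore has right derivative P_s g(x) for every x and every s > 0
(`hasDerivWithinAt_stableSemigroup`). Since P_s g(x) is continuous in s, this is a two-sided
derivative. If moreover P_s f(x) → f(x) and P_s g(x) → g(x) as s → 0⁺, the mean value theorem makes
g(x) the right derivative at s = 0 (`tendsto_semigroupQuotient`).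

Both limits hold at Lebesgue points of f and g, hence almost everywhere: p_t is a rescaling of one
integrable, radially decreasing kernel of mass one, and such a kernel is a superposition of
indicators of balls (`tendsto_lintegral_oscillation`).

Radial monotonicity comes from subordination. With a = α/2, u^a is a multiple of ∫ (1 - e^{-su})
s^{-1-a} ds. Truncating this integral near 0 exhibits e^{-τu^a} as a limit of multiples of
exponentials of Laplace transforms, and after a Gaussian damping their Fourier transforms are limits
of mixtures of Gaussians (`radiallyDecreasing_exp_rpow`). Positivity of the kernel then gives its
integrability by testing against wide Gaussians. -/

noncomputable section

open scoped NNReal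

namespace FracLaplacian

/-! ### Radially decreasing functions -/

section RadiallyDecreasing

variable {V : Type*} [NormedAddCommGroup V]

/-- Nonnegative functions that are nonincreasing functions of the norm. -/
structure RadiallyDecreasing (k : V → ℝ) : Prop where
  nonneg : ∀ z, 0 ≤ k z
  anti : ∀ z w, ‖z‖ ≤ ‖w‖ → k w ≤ k z

theorem RadiallyDecreasing.of_tendsto {k : ℕ → V → ℝ} {l : V → ℝ}
    (hk : ∀ n, RadiallyDecreasing (k n)) (h : ∀ z, Tendsto (fun n => k n z) atTop (𝓝 (l z))) :
    RadiallyDecreasing l where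
  nonneg z := ge_of_tendsto' (h z) fun n => (hk n).nonneg z
  anti z w hzw := le_of_tendsto_of_tendsto' (h w) (h z) fun n => (hk n).anti z w hzw

end RadiallyDecreasing

/-- Laplace transforms of finite measures on the half-line. -/
def IsLaplace (F : ℝ → ℝ) : Prop :=
  ∃ μ : Measure ℝ≥0, IsFiniteMeasure μ ∧ ∀ u, 0 ≤ u → F u = ∫ s, Real.exp (-(s * u)) ∂μ

/-! ### Closure properties of Laplace transforms -/

namespace IsLaplace

theorem integrable_exp (μ : Measure ℝ≥0) [IsFiniteMeasure μ] {u : ℝ} (hu : 0 ≤ u) :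
    Integrable (fun s : ℝ≥0 => Real.exp (-(s * u))) μ := by
  refine Integrable.of_bound (C := 1) (Continuous.aestronglyMeasurable (by fun_prop)) ?_
  filter_upwards with s
  rw [Real.norm_of_nonneg (Real.exp_nonneg _), Real.exp_le_one_iff]
  have : 0 ≤ (s : ℝ) * u := by positivity
  linarith

theorem const {c : ℝ} (hc : 0 ≤ c) : IsLaplace fun _ => c := by
  refine ⟨ENNReal.ofReal c • Measure.dirac 0, ⟨by simp⟩, fun u _ => ?_⟩
  rw [integral_smul_measure, integral_dirac]
  simp [hc]

theorem add {F G : ℝ → ℝ} (hF : IsLaplace F) (hG : IsLaplace G) :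
    IsLaplace fun u => F u + G u := by
  obtain ⟨μ, hμ, hF⟩ := hF
  obtain ⟨ν, hν, hG⟩ := hG
  refine ⟨μ + ν, inferInstance, fun u hu => ?_⟩
  change F u + G u = _
  rw [integral_add_measure (integrable_exp μ hu) (integrable_exp ν hu), hF u hu, hG u hu]

/-- Convolution of the representing measures corresponds to the product of the transforms. -/
theorem mul {F G : ℝ → ℝ} (hF : IsLaplace F) (hG : IsLaplace G) :
    IsLaplace fun u => F u * G u := by
  obtain ⟨μ, hμ, hF⟩ := hF
  obtain ⟨ν, hν, hG⟩ := hG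
  refine ⟨μ.conv ν, inferInstance, fun u hu => ?_⟩
  change F u * G u = _
  rw [integral_conv (integrable_exp _ hu), hF u hu, hG u hu, ← integral_mul_const]
  congr 1
  ext s
  rw [← integral_const_mul]
  congr 1
  ext r
  rw [← Real.exp_add]
  push_cast
  ring_nf

theorem pow {F : ℝ → ℝ} (hF : IsLaplace F) (n : ℕ) : IsLaplace fun u => F u ^ n := by
  induction n with
  | zero => simpa using const zero_le_one
  | succ n ih => simpa [pow_succ] using ih.mul hF

theorem sum {F : ℕ → ℝ → ℝ} (hF : ∀ n, IsLaplace (F n)) (N : ℕ) :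
    IsLaplace fun u => ∑ n ∈ Finset.range N, F n u := by
  induction N with
  | zero => simpa using const le_rfl
  | succ N ih => simpa [Finset.sum_range_succ] using ih.add (hF N)

theorem partialExp {F : ℝ → ℝ} (hF : IsLaplace F) (N : ℕ) :
    IsLaplace fun u => ∑ n ∈ Finset.range N, F u ^ n / n.factorial := by
  refine sum (fun n => ?_) N
  simpa [div_eq_mul_inv] using (hF.pow n).mul (const (c := ((n.factorial : ℝ))⁻¹) (by positivity))

theorem nonneg {F : ℝ → ℝ} (hF : IsLaplace F) {u : ℝ} (hu : 0 ≤ u) : 0 ≤ F u := by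
  obtain ⟨μ, hμ, hF⟩ := hF
  rw [hF u hu]
  positivity

variable {V : Type*} [NormedAddCommGroup V] [MeasurableSpace V] [BorelSpace V]

theorem stronglyMeasurable {F : ℝ → ℝ} (hF : IsLaplace F) [SecondCountableTopology V] :
    StronglyMeasurable fun ξ : V => F (‖ξ‖ ^ 2) := by
  obtain ⟨μ, hμ, hF⟩ := hF
  have : (fun ξ : V => F (‖ξ‖ ^ 2)) =
      fun ξ : V => ∫ s : ℝ≥0, Real.exp (-(s * ‖ξ‖ ^ 2)) ∂μ :=
    funext fun ξ => hF _ (by positivity)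
  rw [this]
  exact StronglyMeasurable.integral_prod_right
    (f := fun (ξ : V) (s : ℝ≥0) => Real.exp (-(s * ‖ξ‖ ^ 2)))
    (Continuous.stronglyMeasurable (by simp only [Function.uncurry_def]; fun_prop))

end IsLaplace

/-! ### Fourier transforms of radial functions as mixtures of Gaussians -/

section CosTransform

variable {V : Type*} [NormedAddCommGroup V] [InnerProductSpace ℝ V] [FiniteDimensional ℝ V]
  [MeasurableSpace V] [BorelSpace V]

/-- The Fourier transform of `ξ ↦ F (|ξ|²)`. -/
def cosTransform (F : ℝ → ℝ) (z : V) : ℝ :=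
  ∫ ξ : V, Real.cos (2 * Real.pi * inner ℝ ξ z) * F (‖ξ‖ ^ 2)

theorem integrable_gaussian {b : ℝ} (hb : 0 < b) :
    Integrable fun ξ : V => Real.exp (-b * ‖ξ‖ ^ 2) := by
  have := (GaussianFourier.integrable_cexp_neg_mul_sq_norm_add (V := V) (b := (b : ℂ))
    (by simpa) 0 0).norm
  convert! this using 2 with ξ
  simp [Complex.norm_exp, ← Complex.ofReal_pow]

theorem integral_cos_gaussian {b : ℝ} (hb : 0 < b) (z : V) :
    ∫ ξ : V, Real.cos (2 * Real.pi * inner ℝ ξ z) * Real.exp (-b * ‖ξ‖ ^ 2) =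
      (Real.pi / b) ^ (Module.finrank ℝ V / 2 : ℝ) * Real.exp (-Real.pi ^ 2 * ‖z‖ ^ 2 / b) := by
  have h := congrArg Complex.re (fourier_gaussian_innerProductSpace (V := V) (b := (b : ℂ))
    (by simpa) z)
  have hint : Integrable fun v : V => Complex.exp ((-2 * Real.pi * inner ℝ v z : ℝ) * Complex.I) •
      Complex.exp (-(b : ℂ) * ‖v‖ ^ 2) := by
    refine (integrable_gaussian (V := V) hb).mono'
      (Continuous.aestronglyMeasurable (by fun_prop)) ?_
    filter_upwards with ξ
    rw [norm_smul, Complex.norm_exp_ofReal_mul_I, one_mul, Complex.norm_exp]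
    simp [← Complex.ofReal_pow]
  rw [Real.fourier_eq', ← RCLike.re_eq_complex_re, ← integral_re hint] at h
  convert! h using 2
  · ext ξ
    have : Complex.exp (-(b : ℂ) * ‖ξ‖ ^ 2) = (Real.exp (-b * ‖ξ‖ ^ 2) : ℝ) := by push_cast; rfl
    rw [this, smul_eq_mul, RCLike.re_eq_complex_re, Complex.re_mul_ofReal,
      Complex.exp_ofReal_mul_I_re]
    congr 1
    rw [← Real.cos_neg]
    ring_nf
  · have h2 : ((Real.pi / b : ℂ) ^ (Module.finrank ℝ V / 2 : ℂ)) =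
        (((Real.pi / b) ^ (Module.finrank ℝ V / 2 : ℝ) : ℝ) : ℂ) := by
      rw [Complex.ofReal_cpow (by positivity)]; push_cast; rfl
    have h3 : Complex.exp (-(Real.pi : ℂ) ^ 2 * ‖z‖ ^ 2 / b) =
        (Real.exp (-Real.pi ^ 2 * ‖z‖ ^ 2 / b) : ℝ) := by push_cast; rfl
    rw [h2, h3, ← Complex.ofReal_mul, RCLike.re_eq_complex_re, Complex.ofReal_re]

theorem radiallyDecreasing_cosTransform_of_tendsto {F : ℕ → ℝ → ℝ} {G : ℝ → ℝ} {B : V → ℝ}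
    (hF : ∀ n, RadiallyDecreasing (cosTransform (V := V) (F n))) (hB : Integrable B)
    (hm : ∀ n, AEStronglyMeasurable (fun ξ : V => F n (‖ξ‖ ^ 2)))
    (hle : ∀ n, ∀ ξ : V, |F n (‖ξ‖ ^ 2)| ≤ B ξ)
    (hlim : ∀ u, 0 ≤ u → Tendsto (fun n => F n u) atTop (𝓝 (G u))) :
    RadiallyDecreasing (cosTransform (V := V) G) := by
  refine RadiallyDecreasing.of_tendsto hF fun z => ?_
  refine tendsto_integral_of_dominated_convergence B
    (fun n => (Continuous.aestronglyMeasurable (by fun_prop)).mul (hm n)) hB ?_ ?_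
  · intro n
    filter_upwards with ξ
    rw [norm_mul, ← one_mul (B ξ)]
    exact mul_le_mul (Real.abs_cos_le_one _) (hle n ξ) (norm_nonneg _) zero_le_one
  · filter_upwards with ξ
    exact (hlim _ (by positivity)).const_mul _

/-- By Fubini the transform is a mixture over `s` of transforms of e^{-(s+δ)|ξ|²}, each a Gaussian
decreasing in |z|. The damping `δ` is needed because `F` alone need not decay: μ may have an atom at
0. -/
theorem IsLaplace.radiallyDecreasing {F : ℝ → ℝ} (hF : IsLaplace F) {δ : ℝ} (hδ : 0 < δ) :
    RadiallyDecreasing (cosTransform (V := V) fun u => Real.exp (-δ * u) * F u) := by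
  obtain ⟨μ, hμ, hF⟩ := hF
  have key : ∀ z : V, cosTransform (fun u => Real.exp (-δ * u) * F u) z =
      ∫ s : ℝ≥0, (Real.pi / (s + δ)) ^ (Module.finrank ℝ V / 2 : ℝ) *
        Real.exp (-Real.pi ^ 2 * ‖z‖ ^ 2 / (s + δ)) ∂μ := by
    intro z
    have h1 : cosTransform (fun u => Real.exp (-δ * u) * F u) z =
        ∫ ξ : V, ∫ s : ℝ≥0, Real.cos (2 * Real.pi * inner ℝ ξ z) *
          Real.exp (-(s + δ) * ‖ξ‖ ^ 2) ∂μ := by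
      refine integral_congr_ae (ae_of_all _ fun ξ => ?_)
      simp only [hF _ (sq_nonneg ‖ξ‖)]
      rw [← mul_assoc, ← integral_const_mul]
      congr 1
      ext s
      rw [mul_assoc, ← Real.exp_add]
      ring_nf
    rw [h1, integral_integral_swap]
    · congr 1
      ext s
      exact integral_cos_gaussian (by positivity) z
    · refine ((integrable_gaussian (V := V) hδ).mul_prod (integrable_const (1 : ℝ) (μ := μ))).mono'
        (Continuous.aestronglyMeasurable (by simp only [Function.uncurry_def]; fun_prop)) ?_
      filter_upwards with ⟨ξ, s⟩
      simp only [Function.uncurry_apply_pair, mul_one, norm_mul]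
      rw [← one_mul (Real.exp (-δ * ‖ξ‖ ^ 2))]
      refine mul_le_mul (Real.abs_cos_le_one _) ?_ (norm_nonneg _) zero_le_one
      rw [Real.norm_of_nonneg (Real.exp_nonneg _)]
      apply Real.exp_le_exp.2
      have : 0 ≤ (s : ℝ) * ‖ξ‖ ^ 2 := by positivity
      linarith
  refine ⟨fun z => ?_, fun z w hzw => ?_⟩
  · rw [key]
    positivity
  · rw [key, key]
    have hint : ∀ z : V, Integrable (fun s : ℝ≥0 =>
        (Real.pi / (s + δ)) ^ (Module.finrank ℝ V / 2 : ℝ) *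
        Real.exp (-Real.pi ^ 2 * ‖z‖ ^ 2 / (s + δ))) μ := by
      intro z
      refine Integrable.of_bound (C := (Real.pi / δ) ^ (Module.finrank ℝ V / 2 : ℝ)) ?_ ?_
      · refine Measurable.aestronglyMeasurable ?_
        fun_prop
      · filter_upwards with s
        rw [Real.norm_of_nonneg (by positivity),
          ← mul_one ((Real.pi / δ) ^ (Module.finrank ℝ V / 2 : ℝ))]
        have hs : 0 < (s : ℝ) + δ := by positivity
        refine mul_le_mul ?_ ?_ (by positivity) (by positivity)
        · refine Real.rpow_le_rpow (by positivity) ?_ (by positivity)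
          exact div_le_div_of_nonneg_left Real.pi_pos.le hδ (by simp)
        · rw [Real.exp_le_one_iff, neg_mul, neg_div, neg_nonpos]
          positivity
    refine integral_mono (hint w) (hint z) fun s => ?_
    have hs : 0 < (s : ℝ) + δ := by positivity
    refine mul_le_mul_of_nonneg_left (Real.exp_le_exp.2 ?_) (by positivity)
    rw [neg_mul, neg_mul, neg_div, neg_div, neg_le_neg_iff]
    gcongr

end CosTransform

/-! ### Subordination and radial monotonicity -/

section Subordination

variable {a : ℝ}

/-- Near 0 the bound 1 - e^{-su} ≤ su leaves u s^{-a}, integrable as a < 1; beyond 1 the bound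
s^{-1-a} is integrable as a > 0. -/
theorem integrableOn_one_sub_exp_mul_rpow (ha₀ : 0 < a) (ha₁ : a < 1) {u : ℝ} (hu : 0 ≤ u) :
    IntegrableOn (fun s : ℝ => (1 - Real.exp (-(s * u))) * s ^ (-1 - a)) (Set.Ioi 0) := by
  have hm : ∀ S : Set ℝ, AEStronglyMeasurable
      (fun s : ℝ => (1 - Real.exp (-(s * u))) * s ^ (-1 - a)) (volume.restrict S) := fun S =>
    Measurable.aestronglyMeasurable (by fun_prop)
  rw [← Set.Ioc_union_Ioi_eq_Ioi zero_le_one]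
  refine IntegrableOn.union ?_ ?_
  · have h1 : IntegrableOn (fun s : ℝ => u * s ^ (-a)) (Set.Ioc 0 1) := by
      have := (intervalIntegral.intervalIntegrable_rpow' (a := 0) (b := 1)
        (r := -a) (by linarith)).const_mul u
      exact (intervalIntegrable_iff_integrableOn_Ioc_of_le zero_le_one).1 this
    refine Integrable.mono' h1 (hm _) ?_
    filter_upwards [ae_restrict_mem measurableSet_Ioc] with s hs
    have hsu : 0 ≤ s * u := mul_nonneg hs.1.le hu
    have h2 : s ^ (-a) = s * s ^ (-1 - a) := by
      rw [← Real.rpow_one_add' hs.1.le (by linarith)]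
      ring_nf
    have h3 : 0 ≤ 1 - Real.exp (-(s * u)) := by
      rw [sub_nonneg, Real.exp_le_one_iff]; linarith
    rw [Real.norm_of_nonneg (mul_nonneg h3 (Real.rpow_nonneg hs.1.le _)), h2, ← mul_assoc]
    refine mul_le_mul_of_nonneg_right ?_ (Real.rpow_nonneg hs.1.le _)
    have := Real.add_one_le_exp (-(s * u))
    linarith
  · refine Integrable.mono' (integrableOn_Ioi_rpow_of_lt (a := -1 - a) (by linarith) one_pos)
      (hm _) ?_
    filter_upwards [ae_restrict_mem measurableSet_Ioi] with s hs
    have hs0 : (0 : ℝ) < s := zero_lt_one.trans hs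
    have hsu : 0 ≤ s * u := mul_nonneg hs0.le hu
    have h3 : 0 ≤ 1 - Real.exp (-(s * u)) := by
      rw [sub_nonneg, Real.exp_le_one_iff]; linarith
    rw [Real.norm_of_nonneg (mul_nonneg h3 (Real.rpow_nonneg hs0.le _))]
    refine mul_le_of_le_one_left (Real.rpow_nonneg hs0.le _) ?_
    have := Real.exp_pos (-(s * u))
    linarith

/-- The constant in `u ^ a = c⁻¹ ∫ (1 - e^{-su}) s^{-1-a} ds`. -/
def subordinationConst (a : ℝ) : ℝ :=
  ∫ s in Set.Ioi (0 : ℝ), (1 - Real.exp (-s)) * s ^ (-1 - a)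

theorem subordinationConst_pos (ha₀ : 0 < a) (ha₁ : a < 1) : 0 < subordinationConst a := by
  have hi := integrableOn_one_sub_exp_mul_rpow ha₀ ha₁ zero_le_one
  simp only [mul_one] at hi
  have hpos : ∀ s ∈ Set.Ioi (0 : ℝ), 0 < (1 - Real.exp (-s)) * s ^ (-1 - a) := by
    intro s hs
    have : Real.exp (-s) < 1 := Real.exp_lt_one_iff.2 (by simpa using hs)
    exact mul_pos (by linarith) (Real.rpow_pos_of_pos hs _)
  rw [subordinationConst, setIntegral_pos_iff_support_of_nonneg_ae ?_ hi]
  · refine lt_of_lt_of_le ?_ (measure_mono (s := Set.Ioi (0 : ℝ)) ?_)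
    · simp
    · exact fun s hs => ⟨(hpos s hs).ne', hs⟩
  · filter_upwards [ae_restrict_mem measurableSet_Ioi] with s hs using (hpos s hs).le

theorem integral_one_sub_exp_mul_rpow (ha₀ : 0 < a) {u : ℝ} (hu : 0 ≤ u) :
    ∫ s in Set.Ioi (0 : ℝ), (1 - Real.exp (-(s * u))) * s ^ (-1 - a) =
      subordinationConst a * u ^ a := by
  rcases hu.eq_or_lt with rfl | hu
  · simp [Real.zero_rpow ha₀.ne']
  have h := integral_comp_mul_right_Ioi (fun s : ℝ => (1 - Real.exp (-s)) * s ^ (-1 - a)) 0 hu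
  rw [zero_mul, smul_eq_mul] at h
  have h1 : ∫ s in Set.Ioi (0 : ℝ), (1 - Real.exp (-(s * u))) * (s * u) ^ (-1 - a) =
      u ^ (-1 - a) * ∫ s in Set.Ioi (0 : ℝ), (1 - Real.exp (-(s * u))) * s ^ (-1 - a) := by
    rw [← integral_const_mul]
    refine setIntegral_congr_fun measurableSet_Ioi fun s hs => ?_
    simp only [Real.mul_rpow (le_of_lt hs) hu.le]
    ring
  rw [h1] at h
  have h2 : u ^ (-1 - a) * (u * u ^ a) = 1 := by
    rw [← Real.rpow_one_add' hu.le (by linarith), ← Real.rpow_add hu]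
    ring_nf
    exact Real.rpow_zero u
  have h3 : u * u⁻¹ = 1 := mul_inv_cancel₀ hu.ne'
  rw [subordinationConst]
  linear_combination (u * u ^ a) * h - (∫ s in Set.Ioi (0 : ℝ),
    (1 - Real.exp (-(s * u))) * s ^ (-1 - a)) * h2 + (u ^ a *
    ∫ s in Set.Ioi (0 : ℝ), (1 - Real.exp (-s)) * s ^ (-1 - a)) * h3

/-- The density s^{-1-a} has infinite mass only near 0, so cutting at ε leaves a finite measure. -/
theorem isLaplace_truncated (ha₀ : 0 < a) {ε : ℝ} (hε : 0 < ε) :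
    IsLaplace fun u => ∫ s in Set.Ioi ε, Real.exp (-(s * u)) * s ^ (-1 - a) := by
  have hi : IntegrableOn (fun s : ℝ => s ^ (-1 - a)) (Set.Ioi ε) :=
    integrableOn_Ioi_rpow_of_lt (by linarith) hε
  let ν : Measure ℝ := (volume.restrict (Set.Ioi ε)).withDensity
    fun s => ENNReal.ofReal (s ^ (-1 - a))
  have hν : IsFiniteMeasure ν := isFiniteMeasure_withDensity_ofReal hi.2
  refine ⟨ν.map Real.toNNReal, inferInstance, fun u _ => ?_⟩
  rw [integral_map (by fun_prop) (Continuous.aestronglyMeasurable (by fun_prop))]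
  rw [integral_withDensity_eq_integral_toReal_smul (by fun_prop) (by simp)]
  refine setIntegral_congr_fun measurableSet_Ioi fun s hs => ?_
  have hs0 : 0 ≤ s := hε.le.trans (le_of_lt hs)
  simp only [Real.coe_toNNReal s hs0, smul_eq_mul]
  rw [ENNReal.toReal_ofReal (Real.rpow_nonneg hs0 _), mul_comm]

variable {V : Type*} [NormedAddCommGroup V] [InnerProductSpace ℝ V] [FiniteDimensional ℝ V]
  [MeasurableSpace V] [BorelSpace V]

/-- Partial sums of the exponential series are again Laplace transforms, and they are all dominated
by exp (F 0). -/
theorem IsLaplace.radiallyDecreasing_exp {F : ℝ → ℝ} (hF : IsLaplace F) {δ : ℝ} (hδ : 0 < δ)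
    (hF0 : ∀ u, 0 ≤ u → F u ≤ F 0) :
    RadiallyDecreasing (cosTransform (V := V) fun u => Real.exp (-δ * u) * Real.exp (F u)) := by
  have hlim : ∀ x : ℝ, Tendsto (fun N => ∑ n ∈ Finset.range N, x ^ n / n.factorial) atTop
      (𝓝 (Real.exp x)) := fun x => by
    rw [Real.exp_eq_exp_ℝ]
    exact (NormedSpace.expSeries_div_hasSum_exp x).tendsto_sum_nat
  refine radiallyDecreasing_cosTransform_of_tendsto
    (F := fun N u => Real.exp (-δ * u) * ∑ n ∈ Finset.range N, F u ^ n / n.factorial)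
    (B := fun ξ => Real.exp (-δ * ‖ξ‖ ^ 2) * Real.exp (F 0))
    (fun N => (hF.partialExp N).radiallyDecreasing hδ)
    ((integrable_gaussian hδ).mul_const _)
    (fun N => (Continuous.aestronglyMeasurable (by fun_prop)).mul
      (hF.partialExp N).stronglyMeasurable.aestronglyMeasurable) ?_ ?_
  · intro N ξ
    have h0 : 0 ≤ F (‖ξ‖ ^ 2) := hF.nonneg (by positivity)
    rw [abs_of_nonneg (by positivity)]
    refine mul_le_mul_of_nonneg_left ?_ (by positivity)
    exact (Real.sum_le_exp_of_nonneg h0 N).trans (Real.exp_le_exp.2 (hF0 _ (by positivity)))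
  · exact fun u hu => (hlim (F u)).const_mul _

theorem radiallyDecreasing_exp_rpow_gaussian (ha₀ : 0 < a) (ha₁ : a < 1) {τ δ : ℝ} (hτ : 0 ≤ τ)
    (hδ : 0 < δ) :
    RadiallyDecreasing (cosTransform (V := V) fun u =>
      Real.exp (-δ * u) * Real.exp (-τ * u ^ a)) := by
  have hc := subordinationConst_pos ha₀ ha₁
  set c := subordinationConst a
  have hε : ∀ n : ℕ, 0 < 1 / ((n : ℝ) + 1) := fun n => by positivity
  let I : ℕ → ℝ → ℝ := fun n u =>
    ∫ s in Set.Ioi (1 / ((n : ℝ) + 1)), (1 - Real.exp (-(s * u))) * s ^ (-1 - a)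
  let L : ℕ → ℝ → ℝ := fun n u =>
    ∫ s in Set.Ioi (1 / ((n : ℝ) + 1)), Real.exp (-(s * u)) * s ^ (-1 - a)
  have hri : ∀ n : ℕ, IntegrableOn (fun s : ℝ => s ^ (-1 - a)) (Set.Ioi (1 / ((n : ℝ) + 1))) :=
    fun n => integrableOn_Ioi_rpow_of_lt (by linarith) (hε n)
  have hIi : ∀ (n : ℕ) (u : ℝ), 0 ≤ u → IntegrableOn
      (fun s : ℝ => (1 - Real.exp (-(s * u))) * s ^ (-1 - a)) (Set.Ioi (1 / ((n : ℝ) + 1))) :=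
    fun n u hu => (integrableOn_one_sub_exp_mul_rpow ha₀ ha₁ hu).mono_set
      (Set.Ioi_subset_Ioi (hε n).le)
  have hI0 : ∀ (n : ℕ) (u : ℝ), 0 ≤ u → 0 ≤ I n u := by
    intro n u hu
    refine setIntegral_nonneg measurableSet_Ioi fun s hs => ?_
    have hs0 : 0 ≤ s := (hε n).le.trans (le_of_lt hs)
    refine mul_nonneg ?_ (Real.rpow_nonneg hs0 _)
    rw [sub_nonneg, Real.exp_le_one_iff, neg_nonpos]
    positivity
  have hIL : ∀ (n : ℕ) (u : ℝ), 0 ≤ u → L n u = L n 0 - I n u := by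
    intro n u hu
    simp only [L, I]
    rw [← integral_sub (by simpa [IntegrableOn] using hri n) (hIi n u hu)]
    congr 1
    ext s
    simp
    ring
  have hIlim : ∀ u, 0 ≤ u → Tendsto (fun n => I n u) atTop (𝓝 (c * u ^ a)) := by
    intro u hu
    rw [← integral_one_sub_exp_mul_rpow ha₀ hu]
    have hcov : AECover (volume.restrict (Set.Ioi (0 : ℝ))) atTop
        fun n : ℕ => Set.Ioi (1 / ((n : ℝ) + 1)) :=
      aecover_Ioi_of_Ioi tendsto_one_div_add_atTop_nhds_zero_nat
    have := hcov.integral_tendsto_of_countably_generated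
      (integrableOn_one_sub_exp_mul_rpow ha₀ ha₁ hu)
    refine this.congr fun n => ?_
    rw [Measure.restrict_restrict measurableSet_Ioi,
      Set.inter_eq_left.2 (Set.Ioi_subset_Ioi (hε n).le)]
  have hLap : ∀ n : ℕ, IsLaplace fun u => τ / c * L n u := fun n =>
    (IsLaplace.const (by positivity)).mul (isLaplace_truncated ha₀ (hε n))
  -- The factor exp(-(τ/c) L n 0) is the constant term of 1 - e^{-su} split off, so the product
  -- stays at most 1 although `L n 0` blows up with `n`.
  have hexp : ∀ (n : ℕ) (u : ℝ), 0 ≤ u → Real.exp (-(τ / c * L n 0)) *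
      Real.exp (τ / c * L n u) = Real.exp (-(τ / c * I n u)) := by
    intro n u hu
    rw [← Real.exp_add, hIL n u hu]
    ring_nf
  have hR : ∀ n : ℕ, RadiallyDecreasing (cosTransform (V := V) fun u =>
      Real.exp (-δ * u) * (Real.exp (-(τ / c * L n 0)) * Real.exp (τ / c * L n u))) := by
    intro n
    have h1 := (hLap n).radiallyDecreasing_exp (V := V) hδ fun u hu => by
      rw [hIL n u hu]
      have := hI0 n u hu
      gcongr
      linarith
    have h2 : (cosTransform (V := V) fun u =>
        Real.exp (-δ * u) * (Real.exp (-(τ / c * L n 0)) * Real.exp (τ / c * L n u))) =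
        fun z => Real.exp (-(τ / c * L n 0)) * cosTransform (V := V) (fun u =>
          Real.exp (-δ * u) * Real.exp (τ / c * L n u)) z := by
      ext z
      simp only [cosTransform]
      refine Eq.trans ?_ (integral_const_mul (μ := (volume : Measure V)) _ _)
      refine congrArg (integral volume) (funext fun ξ => ?_)
      ring
    rw [h2]
    exact ⟨fun z => mul_nonneg (Real.exp_nonneg _) (h1.nonneg z),
      fun z w hzw => mul_le_mul_of_nonneg_left (h1.anti z w hzw) (Real.exp_nonneg _)⟩
  refine radiallyDecreasing_cosTransform_of_tendsto
    (F := fun n u => Real.exp (-δ * u) * (Real.exp (-(τ / c * L n 0)) * Real.exp (τ / c * L n u)))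
    hR (integrable_gaussian (V := V) hδ) ?_ ?_ ?_
  · intro n
    refine (Continuous.aestronglyMeasurable (by fun_prop)).mul (aestronglyMeasurable_const.mul ?_)
    exact Real.continuous_exp.comp_aestronglyMeasurable
      (hLap n).stronglyMeasurable.aestronglyMeasurable
  · intro n ξ
    have hξ : (0 : ℝ) ≤ ‖ξ‖ ^ 2 := by positivity
    rw [hexp n _ hξ, abs_of_nonneg (by positivity)]
    refine mul_le_of_le_one_right (Real.exp_nonneg _) ?_
    rw [Real.exp_le_one_iff, neg_nonpos]
    exact mul_nonneg (by positivity) (hI0 n _ hξ)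
  · intro u hu
    refine Tendsto.const_mul _ ?_
    have h1 : Tendsto (fun n => Real.exp (-(τ / c * I n u))) atTop
        (𝓝 (Real.exp (-(τ / c * (c * u ^ a))))) :=
      (Real.continuous_exp.tendsto _).comp ((hIlim u hu).const_mul _).neg
    have h2 : -(τ / c * (c * u ^ a)) = -τ * u ^ a := by field_simp
    rw [h2] at h1
    exact h1.congr fun n => (hexp n u hu).symm

theorem integrable_exp_neg_mul_rpow [Nontrivial V] {τ b : ℝ} (hτ : 0 < τ) (hb : 0 < b) :
    Integrable fun ξ : V => Real.exp (-τ * ‖ξ‖ ^ b) := by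
  rw [integrable_fun_norm_addHaar (μ := (volume : Measure V))
    (f := fun r => Real.exp (-τ * r ^ b))]
  have h := integrableOn_rpow_mul_exp_neg_mul_rpow (s := (Module.finrank ℝ V - 1 : ℕ)) (p := b)
    (b := τ) (by linarith [Nat.cast_nonneg (α := ℝ) (Module.finrank ℝ V - 1)]) hb hτ
  simpa using h

/-- The damping is now removed (δ → 0), with e^{-τ|ξ|^{2a}} itself as the dominating function. -/
theorem radiallyDecreasing_exp_rpow [Nontrivial V] (ha₀ : 0 < a) (ha₁ : a < 1) {τ : ℝ}
    (hτ : 0 < τ) :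
    RadiallyDecreasing (cosTransform (V := V) fun u => Real.exp (-τ * u ^ a)) := by
  have hpow : ∀ ξ : V, (‖ξ‖ ^ 2) ^ a = ‖ξ‖ ^ (2 * a) := fun ξ => by
    rw [Real.rpow_mul (norm_nonneg _), Real.rpow_two]
  refine radiallyDecreasing_cosTransform_of_tendsto
    (F := fun (n : ℕ) u => Real.exp (-(1 / ((n : ℝ) + 1)) * u) * Real.exp (-τ * u ^ a))
    (fun n => radiallyDecreasing_exp_rpow_gaussian ha₀ ha₁ hτ.le (by positivity))
    (integrable_exp_neg_mul_rpow (V := V) (b := 2 * a) hτ (by positivity)) ?_ ?_ ?_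
  · exact fun n => Measurable.aestronglyMeasurable (by fun_prop)
  · intro n ξ
    rw [abs_of_nonneg (by positivity), hpow]
    refine mul_le_of_le_one_left (Real.exp_nonneg _) ?_
    rw [Real.exp_le_one_iff, neg_mul, neg_nonpos]
    positivity
  · intro u _
    have h1 : Tendsto (fun n : ℕ => Real.exp (-(1 / ((n : ℝ) + 1)) * u)) atTop
        (𝓝 (Real.exp (-0 * u))) :=
      (Real.continuous_exp.tendsto _).comp
        (tendsto_one_div_add_atTop_nhds_zero_nat.neg.mul_const u)
    simpa using h1.mul_const (Real.exp (-τ * u ^ a))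

end Subordination

/-! ### The stable kernel: scaling, integrability, mass and semigroup law -/

section Kernel

variable {d : ℕ} {α : ℝ}

/-- The Fourier transform of `stableKernel d α t`. -/
def stableSymbol (d : ℕ) (α t : ℝ) (ξ : EuclideanSpace ℝ (Fin d)) : ℝ :=
  Real.exp (-t * (2 * Real.pi * ‖ξ‖) ^ α)

theorem continuous_stableSymbol (hα₀ : 0 < α) (t : ℝ) : Continuous (stableSymbol d α t) := by
  unfold stableSymbol
  have : Continuous fun ξ : EuclideanSpace ℝ (Fin d) => (2 * Real.pi * ‖ξ‖) ^ α :=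
    Continuous.rpow_const (by fun_prop) fun _ => Or.inr hα₀.le
  fun_prop

theorem stableSymbol_nonneg (t : ℝ) (ξ : EuclideanSpace ℝ (Fin d)) : 0 ≤ stableSymbol d α t ξ :=
  Real.exp_nonneg _

theorem stableSymbol_le_one {t : ℝ} (ht : 0 ≤ t) (ξ : EuclideanSpace ℝ (Fin d)) :
    stableSymbol d α t ξ ≤ 1 := by
  rw [stableSymbol, Real.exp_le_one_iff, neg_mul, neg_nonpos]
  positivity

theorem stableSymbol_mul (s t : ℝ) (ξ : EuclideanSpace ℝ (Fin d)) :
    stableSymbol d α s ξ * stableSymbol d α t ξ = stableSymbol d α (s + t) ξ := by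
  simp only [stableSymbol, ← Real.exp_add]
  ring_nf

theorem integrable_stableSymbol [NeZero d] (hα₀ : 0 < α) {t : ℝ} (ht : 0 < t) :
    Integrable (stableSymbol d α t) := by
  have h := integrable_exp_neg_mul_rpow (V := EuclideanSpace ℝ (Fin d))
    (τ := t * (2 * Real.pi) ^ α) (by positivity) hα₀
  convert! h using 2 with ξ
  rw [stableSymbol, Real.mul_rpow (by positivity) (norm_nonneg _)]
  ring_nf

theorem ofReal_stableKernel (t : ℝ) (z : EuclideanSpace ℝ (Fin d)) :
    (stableKernel d α t z : ℂ) = 𝓕⁻ (fun ξ => (stableSymbol d α t ξ : ℂ)) z := by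
  simp only [stableSymbol]
  rw [stableKernel, ← Complex.conj_eq_iff_re, Real.fourierInv_eq', ← integral_conj,
    ← integral_neg_eq_self]
  congr 1
  ext ξ
  simp [← Complex.exp_conj, Complex.conj_ofNat]

theorem stableKernel_eq_integral_cos [NeZero d] (hα₀ : 0 < α) {t : ℝ} (ht : 0 < t)
    (z : EuclideanSpace ℝ (Fin d)) :
    stableKernel d α t z =
      ∫ ξ : EuclideanSpace ℝ (Fin d), Real.cos (2 * Real.pi * inner ℝ ξ z) *
        stableSymbol d α t ξ := by
  have hint : Integrable fun v : EuclideanSpace ℝ (Fin d) =>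
      Complex.exp ((2 * Real.pi * inner ℝ v z : ℝ) * Complex.I) •
        ((stableSymbol d α t v : ℝ) : ℂ) := by
    have := continuous_stableSymbol (d := d) hα₀ t
    refine (integrable_stableSymbol (d := d) hα₀ ht).mono'
      (Continuous.aestronglyMeasurable (by fun_prop)) ?_
    filter_upwards with ξ
    rw [norm_smul, Complex.norm_exp_ofReal_mul_I, one_mul, Complex.norm_real,
      Real.norm_of_nonneg (stableSymbol_nonneg _ _)]
  have h := congrArg Complex.re (ofReal_stableKernel (d := d) (α := α) t z)
  rw [Complex.ofReal_re, Real.fourierInv_eq', ← RCLike.re_eq_complex_re, ← integral_re hint] at h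
  rw [h]
  congr 1
  ext ξ
  rw [smul_eq_mul, RCLike.re_eq_complex_re, Complex.re_mul_ofReal, Complex.exp_ofReal_mul_I_re]

theorem radiallyDecreasing_stableKernel [NeZero d] (hα₀ : 0 < α) (hα₂ : α < 2) {t : ℝ}
    (ht : 0 < t) : RadiallyDecreasing (stableKernel d α t) := by
  have h := radiallyDecreasing_exp_rpow (V := EuclideanSpace ℝ (Fin d)) (a := α / 2)
    (τ := t * (2 * Real.pi) ^ α) (by linarith) (by linarith) (by positivity)
  convert! h using 1
  ext z
  rw [stableKernel_eq_integral_cos hα₀ ht, cosTransform]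
  congr 1
  ext ξ
  rw [stableSymbol, ← Real.rpow_two, ← Real.rpow_mul (norm_nonneg _), mul_div_cancel₀ _ two_ne_zero,
    Real.mul_rpow (by positivity) (norm_nonneg _)]
  ring_nf

theorem continuous_stableKernel [NeZero d] (hα₀ : 0 < α) {t : ℝ} (ht : 0 < t) :
    Continuous (stableKernel d α t) := by
  have : stableKernel d α t = fun z => ∫ ξ : EuclideanSpace ℝ (Fin d),
      Real.cos (2 * Real.pi * inner ℝ ξ z) * stableSymbol d α t ξ :=
    funext fun z => stableKernel_eq_integral_cos hα₀ ht z
  rw [this]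
  have hc := continuous_stableSymbol (d := d) hα₀ t
  refine continuous_of_dominated (bound := stableSymbol d α t)
    (fun z => Continuous.aestronglyMeasurable (by fun_prop)) (fun z => ?_)
    (integrable_stableSymbol hα₀ ht) (ae_of_all _ fun ξ => by fun_prop)
  filter_upwards with ξ
  rw [norm_mul, Real.norm_of_nonneg (stableSymbol_nonneg _ _)]
  exact mul_le_of_le_one_left (stableSymbol_nonneg _ _) (Real.abs_cos_le_one _)

theorem stableKernel_scaling [NeZero d] (hα₀ : 0 < α) {t : ℝ} (ht : 0 < t)
    (z : EuclideanSpace ℝ (Fin d)) :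
    stableKernel d α t z =
      (t ^ (-1 / α)) ^ d * stableKernel d α 1 (t ^ (-1 / α) • z) := by
  rw [stableKernel_eq_integral_cos hα₀ ht, stableKernel_eq_integral_cos hα₀ one_pos]
  set r := t ^ (-1 / α) with hr
  have hr0 : 0 < r := Real.rpow_pos_of_pos ht _
  have hrα : t * r ^ α = 1 := by
    rw [hr, ← Real.rpow_mul ht.le, div_mul_cancel₀ _ hα₀.ne', Real.rpow_neg_one,
      mul_inv_cancel₀ ht.ne']
  have h := Measure.integral_comp_smul_of_nonneg
    (volume : Measure (EuclideanSpace ℝ (Fin d))) (fun ξ => Real.cos (2 * Real.pi * inner ℝ ξ z) *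
        stableSymbol d α t ξ) r (hR := hr0.le)
  rw [finrank_euclideanSpace_fin, smul_eq_mul, eq_inv_mul_iff_mul_eq₀ (by positivity)] at h
  rw [← h]
  congr 2
  ext ξ
  rw [real_inner_smul_left, real_inner_smul_right, stableSymbol, stableSymbol, norm_smul,
    Real.norm_of_nonneg hr0.le, mul_left_comm (2 * Real.pi) r (inner ℝ ξ z), mul_left_comm (2 * Real.pi) r ‖ξ‖,
    Real.mul_rpow hr0.le (by positivity)]
  congr 2
  linear_combination (-(2 * Real.pi * ‖ξ‖) ^ α) * hrα

theorem integral_gaussian_fourier {V : Type*} [NormedAddCommGroup V] [InnerProductSpace ℝ V]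
    [FiniteDimensional ℝ V] [MeasurableSpace V] [BorelSpace V] {ε : ℝ} (hε : 0 < ε) :
    ∫ ξ : V, (Real.pi / ε) ^ (Module.finrank ℝ V / 2 : ℝ) *
      Real.exp (-(Real.pi ^ 2 / ε) * ‖ξ‖ ^ 2) = 1 := by
  have hpi := Real.pi_pos
  rw [integral_const_mul, GaussianFourier.integral_rexp_neg_mul_sq_norm (by positivity),
    ← Real.mul_rpow (by positivity) (by positivity)]
  have : Real.pi / ε * (Real.pi / (Real.pi ^ 2 / ε)) = 1 := by field_simp
  rw [this, Real.one_rpow]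

/-- Fubini moves the Fourier transform onto the Gaussian, which becomes a density of mass one,
tested against a symbol bounded by 1. Integrability of the kernel is not needed. -/
theorem integral_stableKernel_mul_gaussian_le [NeZero d] (hα₀ : 0 < α)
    {t ε : ℝ} (ht : 0 < t) (hε : 0 < ε) :
    ∫ z, stableKernel d α t z * Real.exp (-ε * ‖z‖ ^ 2) ≤ 1 := by
  have hc := continuous_stableSymbol (d := d) hα₀ t
  let G : EuclideanSpace ℝ (Fin d) → ℝ := fun ξ =>
    (Real.pi / ε) ^ (Module.finrank ℝ (EuclideanSpace ℝ (Fin d)) / 2 : ℝ) *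
      Real.exp (-(Real.pi ^ 2 / ε) * ‖ξ‖ ^ 2)
  have hG : Integrable G := (integrable_gaussian (by positivity)).const_mul _
  have hG0 : ∀ ξ, 0 ≤ G ξ := fun ξ => by positivity
  have h1 : ∫ z, stableKernel d α t z * Real.exp (-ε * ‖z‖ ^ 2) =
      ∫ ξ, stableSymbol d α t ξ * G ξ := by
    have h2 : ∀ z : EuclideanSpace ℝ (Fin d), stableKernel d α t z * Real.exp (-ε * ‖z‖ ^ 2) =
        ∫ ξ, Real.cos (2 * Real.pi * inner ℝ z ξ) * stableSymbol d α t ξ *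
          Real.exp (-ε * ‖z‖ ^ 2) := by
      intro z
      rw [integral_mul_const, stableKernel_eq_integral_cos hα₀ ht]
      simp only [real_inner_comm]
    simp only [h2]
    rw [integral_integral_swap]
    · congr 1
      ext ξ
      have := integral_cos_gaussian hε ξ
      simp only [G]
      rw [show -(Real.pi ^ 2 / ε) * ‖ξ‖ ^ 2 = -Real.pi ^ 2 * ‖ξ‖ ^ 2 / ε by ring, ← this,
        ← integral_const_mul]
      congr 1
      ext z
      ring
    · refine ((integrable_gaussian hε).mul_prod (integrable_stableSymbol (d := d) hα₀ ht)).mono'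
        (Continuous.aestronglyMeasurable (by simp only [Function.uncurry_def]; fun_prop)) ?_
      filter_upwards with ⟨z, ξ⟩
      simp only [Function.uncurry_apply_pair, norm_mul, Real.norm_of_nonneg (Real.exp_nonneg _),
        Real.norm_of_nonneg (stableSymbol_nonneg t ξ)]
      rw [mul_comm]
      refine mul_le_mul_of_nonneg_left ?_ (Real.exp_nonneg _)
      exact mul_le_of_le_one_left (stableSymbol_nonneg t ξ) (Real.abs_cos_le_one _)
  rw [h1, ← integral_gaussian_fourier (V := EuclideanSpace ℝ (Fin d)) hε]
  refine integral_mono_of_nonneg (ae_of_all _ fun ξ => mul_nonneg (stableSymbol_nonneg t ξ) (hG0 ξ))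
    hG (ae_of_all _ fun ξ => ?_)
  exact mul_le_of_le_one_left (hG0 ξ) (stableSymbol_le_one ht.le ξ)

/-- Since the kernel is nonnegative, Fatou's lemma carries the uniform Gaussian bound to the limit
of ever wider Gaussians. -/
theorem integrable_stableKernel [NeZero d] (hα₀ : 0 < α) (hα₂ : α < 2) {t : ℝ} (ht : 0 < t) :
    Integrable (stableKernel d α t) := by
  have hR := radiallyDecreasing_stableKernel (d := d) hα₀ hα₂ ht
  have hk := continuous_stableKernel (d := d) hα₀ ht
  let F : ℕ → EuclideanSpace ℝ (Fin d) → ℝ := fun n z =>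
    stableKernel d α t z * Real.exp (-(1 / ((n : ℝ) + 1)) * ‖z‖ ^ 2)
  have hF0 : ∀ n z, 0 ≤ F n z := fun n z => mul_nonneg (hR.nonneg z) (Real.exp_nonneg _)
  have hFint : ∀ n, Integrable (F n) := by
    intro n
    refine ((integrable_gaussian (V := EuclideanSpace ℝ (Fin d))
      (b := 1 / ((n : ℝ) + 1)) (by positivity)).const_mul
      (stableKernel d α t 0)).mono' (Continuous.aestronglyMeasurable (by fun_prop)) ?_
    filter_upwards with z
    rw [Real.norm_of_nonneg (hF0 n z)]
    exact mul_le_mul_of_nonneg_right (hR.anti 0 z (by simp)) (Real.exp_nonneg _)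
  have hFle : ∀ n, ∫⁻ z, ENNReal.ofReal (F n z) ≤ 1 := by
    intro n
    rw [← ofReal_integral_eq_lintegral_ofReal (hFint n) (ae_of_all _ (hF0 n)),
      ← ENNReal.ofReal_one]
    exact ENNReal.ofReal_le_ofReal
      (integral_stableKernel_mul_gaussian_le hα₀ ht (by positivity))
  have hlim : ∀ z, Tendsto (fun n => ENNReal.ofReal (F n z)) atTop
      (𝓝 (ENNReal.ofReal (stableKernel d α t z))) := by
    intro z
    refine (ENNReal.continuous_ofReal.tendsto _).comp ?_
    have h1 : Tendsto (fun n : ℕ => Real.exp (-(1 / ((n : ℝ) + 1)) * ‖z‖ ^ 2)) atTop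
        (𝓝 (Real.exp (-0 * ‖z‖ ^ 2))) :=
      (Real.continuous_exp.tendsto _).comp
        (tendsto_one_div_add_atTop_nhds_zero_nat.neg.mul_const _)
    simpa [F] using h1.const_mul (stableKernel d α t z)
  refine ⟨hk.aestronglyMeasurable, ?_⟩
  rw [hasFiniteIntegral_iff_ofReal (ae_of_all _ hR.nonneg)]
  have h := lintegral_liminf_le' (μ := (volume : Measure (EuclideanSpace ℝ (Fin d))))
    (u := atTop) (f := fun n z => ENNReal.ofReal (F n z))
    fun n => (hFint n).aemeasurable.ennreal_ofReal
  simp only [fun z => (hlim z).liminf_eq] at h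
  refine (h.trans ?_).trans_lt ENNReal.one_lt_top
  exact liminf_le_of_frequently_le' (Frequently.of_forall hFle)

theorem fourier_stableKernel [NeZero d] (hα₀ : 0 < α) (hα₂ : α < 2) {t : ℝ} (ht : 0 < t) :
    𝓕 (fun z => (stableKernel d α t z : ℂ)) = fun ξ => (stableSymbol d α t ξ : ℂ) := by
  have hk : (fun z => (stableKernel d α t z : ℂ)) = 𝓕⁻ (fun ξ => (stableSymbol d α t ξ : ℂ)) :=
    funext (ofReal_stableKernel t)
  have hi := (integrable_stableKernel (d := d) hα₀ hα₂ ht).ofReal (𝕜 := ℂ)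
  rw [hk]
  refine Continuous.fourier_fourierInv_eq
    (Complex.continuous_ofReal.comp (continuous_stableSymbol hα₀ t))
    (integrable_stableSymbol hα₀ ht).ofReal ?_
  have : 𝓕 (fun ξ => (stableSymbol d α t ξ : ℂ)) = fun z => (stableKernel d α t (-z) : ℂ) := by
    ext z
    rw [ofReal_stableKernel, Real.fourierInv_eq_fourier_neg, neg_neg]
  rw [this]
  exact hi.comp_neg

theorem integral_stableKernel [NeZero d] (hα₀ : 0 < α) (hα₂ : α < 2) {t : ℝ} (ht : 0 < t) :
    ∫ z, stableKernel d α t z = 1 := by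
  have h := congrFun (fourier_stableKernel (d := d) hα₀ hα₂ ht) 0
  rw [Real.fourier_eq'] at h
  simp only [inner_zero_right, mul_zero, Complex.ofReal_zero, zero_mul, Complex.exp_zero,
    one_smul] at h
  rw [integral_complex_ofReal] at h
  have h2 : stableSymbol d α t 0 = 1 := by simp [stableSymbol, hα₀.ne']
  rw [h2] at h
  exact_mod_cast h

theorem stableKernel_le [NeZero d] (hα₀ : 0 < α) (hα₂ : α < 2) {t : ℝ} (ht : 0 < t)
    (z : EuclideanSpace ℝ (Fin d)) : ‖stableKernel d α t z‖ ≤ stableKernel d α t 0 := by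
  have hR := radiallyDecreasing_stableKernel (d := d) hα₀ hα₂ ht
  rw [Real.norm_of_nonneg (hR.nonneg z)]
  exact hR.anti 0 z (by simp)

/-- The symbols multiply, and Fourier inversion applies to the convolution because it is continuous
and integrable. -/
theorem stableKernel_convolution [NeZero d] (hα₀ : 0 < α) (hα₂ : α < 2) {s t : ℝ} (hs : 0 < s)
    (ht : 0 < t) :
    convolution (stableKernel d α s) (stableKernel d α t) (ContinuousLinearMap.lsmul ℝ ℝ) volume =
      stableKernel d α (s + t) := by
  have his : Integrable fun z => (stableKernel d α s z : ℂ) :=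
    (integrable_stableKernel hα₀ hα₂ hs).ofReal
  have hit : Integrable fun z => (stableKernel d α t z : ℂ) :=
    (integrable_stableKernel hα₀ hα₂ ht).ofReal
  let C := convolution (fun z => (stableKernel d α s z : ℂ)) (fun z => (stableKernel d α t z : ℂ))
    (ContinuousLinearMap.lsmul ℂ ℂ) volume
  have hF : 𝓕 C = fun ξ => (stableSymbol d α (s + t) ξ : ℂ) := by
    ext ξ
    refine (Real.fourier_smul_convolution_eq his hit ξ).trans ?_
    rw [fourier_stableKernel hα₀ hα₂ hs,
      fourier_stableKernel hα₀ hα₂ ht, smul_eq_mul, ← Complex.ofReal_mul, stableSymbol_mul]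
  have hCc : Continuous C := by
    refine BddAbove.continuous_convolution_right_of_integrable _ ?_ his
      (Complex.continuous_ofReal.comp (continuous_stableKernel hα₀ ht))
    refine ⟨stableKernel d α t 0, ?_⟩
    rintro _ ⟨z, rfl⟩
    simpa using stableKernel_le hα₀ hα₂ ht z
  have hCi : Integrable C := his.integrable_convolution _ hit
  have hinv := hCc.fourierInv_fourier_eq hCi
    (by rw [hF]; exact (integrable_stableSymbol hα₀ (by positivity)).ofReal)
  ext z
  have h1 : (stableKernel d α (s + t) z : ℂ) = C z := by
    rw [ofReal_stableKernel, ← hinv, hF]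
  apply Complex.ofReal_injective
  rw [h1]
  simp only [C, convolution]
  rw [← integral_complex_ofReal]
  simp

/-- The kernel is integrable and bounded by its value at 0, so its q-th power is at most
p_t(0)^{q-1} p_t. -/
theorem memLp_stableKernel [NeZero d] (hα₀ : 0 < α) (hα₂ : α < 2) {t : ℝ} (ht : 0 < t)
    {q : ℝ≥0∞} (hq : 1 ≤ q) : MemLp (stableKernel d α t) q := by
  have hi := integrable_stableKernel (d := d) hα₀ hα₂ ht
  have hR := radiallyDecreasing_stableKernel (d := d) hα₀ hα₂ ht
  rcases eq_or_ne q ∞ with rfl | hq'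
  · exact memLp_top_of_bound hi.1 _ (ae_of_all _ (stableKernel_le hα₀ hα₂ ht))
  have hq0 : q ≠ 0 := (zero_lt_one.trans_le hq).ne'
  have hq1 : 1 ≤ q.toReal := by
    rw [← ENNReal.toReal_one]; exact ENNReal.toReal_mono hq' hq
  rw [← integrable_norm_rpow_iff hi.1 hq0 hq']
  refine (hi.const_mul (stableKernel d α t 0 ^ (q.toReal - 1))).mono' ?_ ?_
  · exact (hi.1.norm.aemeasurable.pow_const _).aestronglyMeasurable
  · filter_upwards with z
    rw [Real.norm_of_nonneg (by positivity)]
    have h0 := hR.nonneg z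
    have : ‖stableKernel d α t z‖ ^ q.toReal =
        ‖stableKernel d α t z‖ ^ (q.toReal - 1) * stableKernel d α t z := by
      nth_rw 3 [← Real.norm_of_nonneg h0]
      rw [← Real.rpow_add_one' (norm_nonneg _) (by linarith)]
      simp
    rw [this]
    exact mul_le_mul_of_nonneg_right (Real.rpow_le_rpow (norm_nonneg _)
      (stableKernel_le hα₀ hα₂ ht z) (by linarith)) h0

end Kernel

/-! ### The semigroup at positive times -/

section Semigroup

variable {𝕜 : Type*} [RCLike 𝕜] {d : ℕ} {α : ℝ} {p : ℝ≥0∞}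

theorem stableSemigroup_apply (t : ℝ) (f : EuclideanSpace ℝ (Fin d) → 𝕜)
    (x : EuclideanSpace ℝ (Fin d)) :
    stableSemigroup α t f x = ∫ z, stableKernel d α t z • f (x - z) := rfl

theorem memLp_comp_sub_left {f : EuclideanSpace ℝ (Fin d) → 𝕜} (hf : MemLp f p)
    (x : EuclideanSpace ℝ (Fin d)) : MemLp (fun z => f (x - z)) p :=
  hf.comp_measurePreserving (Measure.measurePreserving_sub_left volume x)

variable [NeZero d]

theorem integrable_stableKernel_smul (hα₀ : 0 < α) (hα₂ : α < 2) {t : ℝ} (ht : 0 < t)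
    (hp : 1 ≤ p) {f : EuclideanSpace ℝ (Fin d) → 𝕜} (hf : MemLp f p)
    (x : EuclideanSpace ℝ (Fin d)) :
    Integrable fun z => stableKernel d α t z • f (x - z) := by
  have : p.HolderConjugate p.conjExponent := ENNReal.HolderConjugate.conjExponent hp
  have : p.conjExponent.HolderConjugate p := ENNReal.HolderConjugate.symm
  have hk := memLp_stableKernel (d := d) hα₀ hα₂ ht
    (ENNReal.HolderConjugate.one_le p.conjExponent p)
  exact memLp_one_iff_integrable.1 ((memLp_comp_sub_left hf x).smul hk)

theorem convolutionExistsAt_stableKernel (hα₀ : 0 < α) (hα₂ : α < 2) {t : ℝ} (ht : 0 < t)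
    (hp : 1 ≤ p) {f : EuclideanSpace ℝ (Fin d) → 𝕜} (hf : MemLp f p)
    (x : EuclideanSpace ℝ (Fin d)) :
    ConvolutionExistsAt (stableKernel d α t) f x (ContinuousLinearMap.lsmul ℝ ℝ) volume :=
  integrable_stableKernel_smul hα₀ hα₂ ht hp hf x

/-- Hölder's inequality, with C the norm of p_t in the conjugate exponent. Uniformity in `u` and `x`
is what converts L^p limits into limits at every point. -/
theorem exists_enorm_stableSemigroup_le (𝕜 : Type*) [RCLike 𝕜] (hα₀ : 0 < α) (hα₂ : α < 2) {t : ℝ}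
    (ht : 0 < t) (hp : 1 ≤ p) :
    ∃ C : ℝ≥0∞, C ≠ ∞ ∧ ∀ u : EuclideanSpace ℝ (Fin d) → 𝕜, AEStronglyMeasurable u →
      ∀ x, ‖stableSemigroup α t u x‖ₑ ≤ C * eLpNorm u p := by
  have : p.HolderConjugate p.conjExponent := ENNReal.HolderConjugate.conjExponent hp
  have : p.conjExponent.HolderConjugate p := ENNReal.HolderConjugate.symm
  have hk := memLp_stableKernel (d := d) hα₀ hα₂ ht
    (ENNReal.HolderConjugate.one_le p.conjExponent p)
  refine ⟨_, hk.2.ne, fun u hu x => ?_⟩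
  have hmp := Measure.measurePreserving_sub_left
    (volume : Measure (EuclideanSpace ℝ (Fin d))) x
  have hu' : AEStronglyMeasurable (fun z => u (x - z)) := hu.comp_measurePreserving hmp
  have h1 : eLpNorm (fun z => u (x - z)) p volume = eLpNorm u p volume :=
    eLpNorm_comp_measurePreserving hu hmp
  have h2 := eLpNorm_smul_le_mul_eLpNorm (p := p.conjExponent) (q := p) (r := 1) hu' hk.1
  rw [stableSemigroup_apply, ← h1]
  refine (enorm_integral_le_lintegral_enorm _).trans ?_
  rw [← eLpNorm_one_eq_lintegral_enorm]
  exact h2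

theorem aestronglyMeasurable_stableSemigroup (hα₀ : 0 < α) {t : ℝ} (ht : 0 < t)
    {f : EuclideanSpace ℝ (Fin d) → 𝕜} (hf : AEStronglyMeasurable f) :
    AEStronglyMeasurable (stableSemigroup α t f) :=
  ((continuous_stableKernel hα₀ ht).aestronglyMeasurable.convolution_integrand
    (ContinuousLinearMap.lsmul ℝ ℝ) hf).integral_prod_right'

theorem exists_norm_stableSemigroup_le (hα₀ : 0 < α) (hα₂ : α < 2) {t : ℝ} (ht : 0 < t)
    (hp : 1 ≤ p) {f : EuclideanSpace ℝ (Fin d) → 𝕜} (hf : MemLp f p) :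
    ∃ M : ℝ, ∀ x, ‖stableSemigroup α t f x‖ ≤ M := by
  obtain ⟨C, hC, hle⟩ := exists_enorm_stableSemigroup_le (d := d) 𝕜 hα₀ hα₂ ht hp
  refine ⟨(C * eLpNorm f p).toReal, fun x => ?_⟩
  rw [← toReal_enorm]
  exact ENNReal.toReal_mono (ENNReal.mul_ne_top hC hf.2.ne) (hle f hf.1 x)

theorem integrable_stableKernel_smul_stableSemigroup (hα₀ : 0 < α) (hα₂ : α < 2) {s t : ℝ}
    (hs : 0 < s) (ht : 0 < t) (hp : 1 ≤ p) {f : EuclideanSpace ℝ (Fin d) → 𝕜} (hf : MemLp f p)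
    (x : EuclideanSpace ℝ (Fin d)) :
    Integrable fun z => stableKernel d α s z • stableSemigroup α t f (x - z) := by
  obtain ⟨M, hM⟩ := exists_norm_stableSemigroup_le hα₀ hα₂ ht hp hf
  have hk := integrable_stableKernel (d := d) hα₀ hα₂ hs
  refine (hk.norm.mul_const M).mono' ?_ ?_
  · exact hk.1.smul ((aestronglyMeasurable_stableSemigroup hα₀ ht hf.1).comp_measurePreserving
      (Measure.measurePreserving_sub_left volume x))
  · filter_upwards with z
    rw [norm_smul]
    exact mul_le_mul_of_nonneg_left (hM _) (norm_nonneg _)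

theorem stableSemigroup_stableSemigroup (hα₀ : 0 < α) (hα₂ : α < 2) {s t : ℝ}
    (hs : 0 < s) (ht : 0 < t) (hp : 1 ≤ p) {f : EuclideanSpace ℝ (Fin d) → 𝕜} (hf : MemLp f p)
    (x : EuclideanSpace ℝ (Fin d)) :
    stableSemigroup α s (stableSemigroup α t f) x = stableSemigroup α (s + t) f x := by
  have hks := integrable_stableKernel (d := d) hα₀ hα₂ hs
  have hkt := integrable_stableKernel (d := d) hα₀ hα₂ ht
  have hnorm : (fun z => ‖stableKernel d α t z‖) = stableKernel d α t :=
    funext fun z => Real.norm_of_nonneg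
      ((radiallyDecreasing_stableKernel hα₀ hα₂ ht).nonneg z)
  symm
  rw [stableSemigroup, ← stableKernel_convolution hα₀ hα₂ hs ht]
  refine convolution_assoc (ContinuousLinearMap.lsmul ℝ ℝ) (ContinuousLinearMap.lsmul ℝ ℝ)
    (ContinuousLinearMap.lsmul ℝ ℝ) (ContinuousLinearMap.lsmul ℝ ℝ) (fun a b c => ?_)
    hks.1 hkt.1 hf.1 (hks.ae_convolution_exists _ hkt) (ae_of_all _ fun y => ?_) ?_
  · simp only [ContinuousLinearMap.lsmul_apply, smul_assoc]
  · have := (integrable_stableKernel_smul hα₀ hα₂ ht hp hf y).norm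
    simpa only [ConvolutionExistsAt, ContinuousLinearMap.mul_apply', norm_smul] using this
  · rw [hnorm]
    refine (integrable_stableKernel_smul_stableSemigroup hα₀ hα₂ hs ht hp hf.norm x).congr
      (ae_of_all _ fun z => ?_)
    simp only [ContinuousLinearMap.mul_apply', smul_eq_mul]
    rw [Real.norm_of_nonneg ((radiallyDecreasing_stableKernel hα₀ hα₂ hs).nonneg z)]
    rfl

theorem continuousAt_stableKernel_time (hα₀ : 0 < α) {t : ℝ} (ht : 0 < t)
    (z : EuclideanSpace ℝ (Fin d)) : ContinuousAt (fun s => stableKernel d α s z) t := by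
  have h : (fun s => (s ^ (-1 / α)) ^ d * stableKernel d α 1 (s ^ (-1 / α) • z)) =ᶠ[𝓝 t]
      fun s => stableKernel d α s z := by
    filter_upwards [Ioi_mem_nhds ht] with s hs using (stableKernel_scaling hα₀ hs z).symm
  refine ContinuousAt.congr ?_ h
  have hr : ContinuousAt (fun s : ℝ => s ^ (-1 / α)) t :=
    Real.continuousAt_rpow_const _ _ (Or.inl ht.ne')
  refine (hr.pow d).mul ?_
  exact (continuous_stableKernel hα₀ one_pos).continuousAt.comp (hr.smul continuousAt_const)

/-- By scaling, a larger time evaluates the unit-time kernel closer to 0, where it is larger; only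
the prefactors must be compensated. This dominates all kernels with time in [r, t] by a single one.
-/
theorem stableKernel_le_mul (hα₀ : 0 < α) (hα₂ : α < 2) {r s t : ℝ} (hr : 0 < r) (hrs : r ≤ s)
    (hst : s ≤ t) (z : EuclideanSpace ℝ (Fin d)) :
    stableKernel d α s z ≤
      (r ^ (-1 / α)) ^ d * ((t ^ (-1 / α)) ^ d)⁻¹ * stableKernel d α t z := by
  have hs : 0 < s := hr.trans_le hrs
  have ht : 0 < t := hs.trans_le hst
  have hR := radiallyDecreasing_stableKernel (d := d) hα₀ hα₂ one_pos
  have hneg : -1 / α ≤ 0 := by rw [neg_div, neg_nonpos]; positivity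
  rw [stableKernel_scaling hα₀ hs, stableKernel_scaling hα₀ ht, mul_assoc,
    inv_mul_cancel_left₀ (by positivity)]
  refine mul_le_mul ?_ (hR.anti _ _ ?_) (hR.nonneg _) (by positivity)
  · exact pow_le_pow_left₀ (by positivity) (Real.rpow_le_rpow_of_nonpos hr hrs hneg) d
  · rw [norm_smul, norm_smul, Real.norm_of_nonneg (by positivity),
      Real.norm_of_nonneg (by positivity)]
    exact mul_le_mul_of_nonneg_right (Real.rpow_le_rpow_of_nonpos hs hst hneg) (norm_nonneg _)

theorem continuousAt_stableSemigroup_time (hα₀ : 0 < α) (hα₂ : α < 2) {t : ℝ} (ht : 0 < t)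
    (hp : 1 ≤ p) {f : EuclideanSpace ℝ (Fin d) → 𝕜} (hf : MemLp f p)
    (x : EuclideanSpace ℝ (Fin d)) : ContinuousAt (fun s => stableSemigroup α s f x) t := by
  simp only [stableSemigroup_apply]
  have h2t : 0 < 2 * t := by linarith
  refine continuousAt_of_dominated
    (bound := fun z => ((t / 2) ^ (-1 / α)) ^ d * (((2 * t) ^ (-1 / α)) ^ d)⁻¹ *
      ‖stableKernel d α (2 * t) z • f (x - z)‖) ?_ ?_ ?_ ?_
  · filter_upwards [Ioi_mem_nhds ht] with s hs
    exact (integrable_stableKernel_smul hα₀ hα₂ hs hp hf x).1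
  · filter_upwards [Ioo_mem_nhds (show t / 2 < t by linarith) (show t < 2 * t by linarith)]
      with s hs
    filter_upwards with z
    have h := stableKernel_le_mul (d := d) hα₀ hα₂ (show 0 < t / 2 by linarith) hs.1.le hs.2.le z
    have hs0 : 0 < s := lt_trans (by linarith) hs.1
    rw [norm_smul, norm_smul, ← mul_assoc,
      Real.norm_of_nonneg ((radiallyDecreasing_stableKernel hα₀ hα₂ hs0).nonneg z),
      Real.norm_of_nonneg ((radiallyDecreasing_stableKernel hα₀ hα₂ h2t).nonneg z)]
    exact mul_le_mul_of_nonneg_right h (norm_nonneg _)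
  · exact (integrable_stableKernel_smul hα₀ hα₂ h2t hp hf x).norm.const_mul _
  · filter_upwards with z
    exact (continuousAt_stableKernel_time hα₀ ht z).smul continuousAt_const

theorem stableSemigroup_semigroupQuotient_sub (hα₀ : 0 < α) (hα₂ : α < 2) {s t : ℝ}
    (hs : 0 < s) (ht : 0 < t) (hp : 1 ≤ p) {f g : EuclideanSpace ℝ (Fin d) → 𝕜} (hf : MemLp f p)
    (hg : MemLp g p) (x : EuclideanSpace ℝ (Fin d)) :
    stableSemigroup α s (semigroupQuotient α t f - g) x =
      t⁻¹ • (stableSemigroup α (s + t) f x - stableSemigroup α s f x) -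
        stableSemigroup α s g x := by
  have h1 := integrable_stableKernel_smul_stableSemigroup hα₀ hα₂ hs ht hp hf x
  have h2 := integrable_stableKernel_smul hα₀ hα₂ hs hp hf x
  have h3 := integrable_stableKernel_smul hα₀ hα₂ hs hp hg x
  rw [← stableSemigroup_stableSemigroup hα₀ hα₂ hs ht hp hf]
  rw [stableSemigroup_apply s (semigroupQuotient α t f - g),
    stableSemigroup_apply s (stableSemigroup α t f), stableSemigroup_apply s f,
    stableSemigroup_apply s g, ← integral_sub h1 h2, ← integral_smul]
  refine Eq.trans ?_ (integral_sub ((h1.sub h2).smul t⁻¹) h3)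
  congr 1
  ext z
  simp only [Pi.sub_apply, semigroupQuotient, smul_sub, smul_comm t⁻¹]

/-- The slope minus P_s g(x) is P_s applied to the L^p error of the quotient with increment y - s,
so the pointwise Hölder bound applies. -/
theorem hasDerivWithinAt_stableSemigroup (hα₀ : 0 < α) (hα₂ : α < 2) {s : ℝ}
    (hs : 0 < s) (hp : 1 ≤ p) {f g : EuclideanSpace ℝ (Fin d) → 𝕜}
    (h : HasSemigroupLimitLp α p f g) (x : EuclideanSpace ℝ (Fin d)) :
    HasDerivWithinAt (fun s => stableSemigroup α s f x) (stableSemigroup α s g x)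
      (Set.Ioi s) s := by
  obtain ⟨hf, hg, hlim⟩ := h
  obtain ⟨C, hC, hle⟩ := exists_enorm_stableSemigroup_le (d := d) 𝕜 hα₀ hα₂ hs hp
  rw [hasDerivWithinAt_iff_tendsto_slope' (by simp), tendsto_iff_edist_tendsto_0]
  have hsub : Tendsto (fun y : ℝ => y - s) (𝓝[>] s) (𝓝[>] 0) := by
    refine tendsto_nhdsWithin_iff.2 ⟨?_, ?_⟩
    · have : Tendsto (fun y : ℝ => y - s) (𝓝 s) (𝓝 (s - s)) := tendsto_id.sub_const s
      rw [sub_self] at this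
      exact this.mono_left nhdsWithin_le_nhds
    · filter_upwards [self_mem_nhdsWithin] with y hy using sub_pos.2 (Set.mem_Ioi.1 hy)
  have hup := ENNReal.Tendsto.const_mul (a := C) (hlim.comp hsub) (Or.inr hC)
  rw [mul_zero] at hup
  refine tendsto_of_tendsto_of_tendsto_of_le_of_le' tendsto_const_nhds hup
    (Eventually.of_forall fun _ => zero_le) ?_
  filter_upwards [self_mem_nhdsWithin] with y hy
  have hy' : 0 < y - s := sub_pos.2 hy
  have heq := stableSemigroup_semigroupQuotient_sub hα₀ hα₂ hs hy' hp hf hg x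
  rw [add_sub_cancel] at heq
  rw [edist_eq_enorm_sub, slope_def_module, ← heq]
  refine hle _ ?_ x
  exact (((aestronglyMeasurable_stableSemigroup hα₀ hy' hf.1).sub hf.1).const_smul _).sub hg.1

end Semigroup

/-! ### Radially decreasing approximate identities at Lebesgue points -/

section ApproximateIdentity

variable {V : Type*} [NormedAddCommGroup V] [InnerProductSpace ℝ V] [FiniteDimensional ℝ V]
  [MeasurableSpace V] [BorelSpace V]

theorem RadiallyDecreasing.superlevel_eq_ball [Nontrivial V] {k : V → ℝ}
    (hk : RadiallyDecreasing k) (hc : Continuous k) (hi : Integrable k) {l : ℝ} (hl : 0 < l) :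
    ∃ ρ : ℝ, {z | l < k z} = Metric.ball (0 : V) ρ := by
  set S := {z | l < k z} with hS
  have hopen : IsOpen S := isOpen_lt continuous_const hc
  have hdown : ∀ z w, ‖z‖ ≤ ‖w‖ → w ∈ S → z ∈ S := fun z w h hw => lt_of_lt_of_le hw (hk.anti z w h)
  have hfin : volume S < ∞ := hi.measure_gt_lt_top hl
  rcases S.eq_empty_or_nonempty with he | hne
  · exact ⟨0, by rw [he, Metric.ball_zero]⟩
  have hbdd : BddAbove ((fun z : V => ‖z‖) '' S) := by
    by_contra hnb
    have huniv : S = Set.univ := by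
      refine Set.eq_univ_of_forall fun z => ?_
      obtain ⟨_, ⟨w, hw, rfl⟩, hzw⟩ := not_bddAbove_iff.1 hnb ‖z‖
      exact hdown z w hzw.le hw
    rw [huniv, measure_univ_of_isAddLeftInvariant] at hfin
    exact lt_irrefl _ hfin
  refine ⟨sSup ((fun z : V => ‖z‖) '' S), Set.Subset.antisymm (fun z hz => ?_) fun z hz => ?_⟩
  · rw [mem_ball_zero_iff]
    -- As the set is open, a small outward step stays inside and shows that ‖z‖ is strictly below
    -- the supremum. At z = 0 any unit vector serves as the direction.
    obtain ⟨v, hv⟩ : ∃ v : V, ‖v‖ = 1 := exists_norm_eq V zero_le_one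
    obtain ⟨e, he0, hez⟩ : ∃ e : V, (z = 0 → ‖e‖ = 1) ∧ (z ≠ 0 → e = z) := by
      rcases eq_or_ne z 0 with h | h
      · exact ⟨v, fun _ => hv, fun h' => absurd h h'⟩
      · exact ⟨z, fun h' => absurd h' h, fun _ => rfl⟩
    have hcont : ContinuousAt (fun r : ℝ => z + r • e) 0 := by fun_prop
    have hmem : ∀ᶠ r : ℝ in 𝓝[>] 0, z + r • e ∈ S := by
      refine (hcont.eventually (hopen.mem_nhds ?_)).filter_mono nhdsWithin_le_nhds
      simpa using hz
    obtain ⟨r, hrS, hr⟩ := (hmem.and self_mem_nhdsWithin).exists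
    have hr0 : 0 < r := hr
    refine lt_of_lt_of_le ?_ (le_csSup hbdd ⟨_, hrS, rfl⟩)
    by_cases hz0 : z = 0
    · simp only [hz0, zero_add, norm_zero, norm_smul, he0 hz0, mul_one, Real.norm_of_nonneg hr0.le,
        hr0]
    · have h1 : z + r • e = (1 + r) • z := by rw [hez hz0, add_smul, one_smul]
      have : 0 < ‖z‖ := norm_pos_iff.2 hz0
      simp only [h1, norm_smul, Real.norm_of_nonneg (show 0 ≤ 1 + r by linarith)]
      nlinarith
  · rw [mem_ball_zero_iff] at hz
    obtain ⟨_, ⟨w, hw, rfl⟩, hzw⟩ := exists_lt_of_lt_csSup (hne.image _) hz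
    exact hdown z w hzw.le hw

theorem lintegral_ball_rescale (g : V → ℝ≥0∞) (x : V) {r : ℝ} (hr : 0 < r) (ρ : ℝ) :
    ∫⁻ w in Metric.ball 0 ρ, g (x - r • w) =
      ENNReal.ofReal (r ^ Module.finrank ℝ V)⁻¹ * ∫⁻ y in Metric.ball x (r * ρ), g y := by
  have hemb1 : MeasurableEmbedding fun w : V => r • w :=
    (Homeomorph.smulOfNeZero r hr.ne').measurableEmbedding
  have hemb2 : MeasurableEmbedding fun w : V => x - w :=
    (Homeomorph.subLeft x).measurableEmbedding
  have hpre2 : (fun w : V => x - w) ⁻¹' Metric.ball x (r * ρ) = Metric.ball 0 (r * ρ) := by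
    ext w
    simp [dist_eq_norm]
  have hpre1 : (fun w : V => r • w) ⁻¹' Metric.ball 0 (r * ρ) = Metric.ball 0 ρ := by
    ext w
    simp [norm_smul, abs_of_pos hr, hr]
  rw [← (Measure.measurePreserving_sub_left (volume : Measure V) x).setLIntegral_comp_preimage_emb
    hemb2 g (Metric.ball x (r * ρ)), hpre2]
  have h := Measure.map_addHaar_smul (volume : Measure V) hr.ne'
  rw [abs_of_pos (by positivity)] at h
  rw [← smul_eq_mul, ← lintegral_smul_measure, ← Measure.restrict_smul, ← h, hemb1.restrict_map,
    hemb1.lintegral_map, hpre1]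

/-- The mean of `|f - f x|` over the closed ball of radius `r` around `x`. -/
def meanOscillation {E : Type*} [NormedAddCommGroup E] (f : V → E) (x : V) (r : ℝ) : ℝ≥0∞ :=
  (∫⁻ y in Metric.closedBall x r, ‖f y - f x‖ₑ) / volume (Metric.closedBall x r)

theorem lintegral_ball_rescale_le {E : Type*} [NormedAddCommGroup E] (f : V → E) (x : V) {r ρ : ℝ}
    (hr : 0 < r) (hρ : 0 < ρ) :
    ∫⁻ w in Metric.ball 0 ρ, ‖f (x - r • w) - f x‖ₑ ≤
      volume (Metric.ball (0 : V) ρ) * meanOscillation f x (r * ρ) := by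
  have hrρ : 0 < r * ρ := mul_pos hr hρ
  rw [lintegral_ball_rescale (fun y => ‖f y - f x‖ₑ) x hr]
  have hvol : volume (Metric.closedBall x (r * ρ)) =
      ENNReal.ofReal (r ^ Module.finrank ℝ V) * volume (Metric.ball (0 : V) ρ) := by
    rw [Measure.addHaar_closedBall _ _ hrρ.le, Measure.addHaar_ball_of_pos _ _ hρ, mul_pow,
      ENNReal.ofReal_mul (by positivity), mul_assoc]
  have hb0 : volume (Metric.ball (0 : V) ρ) ≠ 0 := (Metric.measure_ball_pos _ _ hρ).ne'
  have hbt : volume (Metric.ball (0 : V) ρ) ≠ ∞ := measure_ball_lt_top.ne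
  have hrp : 0 < r ^ Module.finrank ℝ V := by positivity
  have heq : volume (Metric.ball (0 : V) ρ) * meanOscillation f x (r * ρ) =
      ENNReal.ofReal (r ^ Module.finrank ℝ V)⁻¹ *
        ∫⁻ y in Metric.closedBall x (r * ρ), ‖f y - f x‖ₑ := by
    rw [meanOscillation, hvol, div_eq_mul_inv, ENNReal.mul_inv (Or.inr hbt) (Or.inr hb0),
      ENNReal.ofReal_inv_of_pos hrp]
    rw [mul_left_comm, mul_comm, mul_left_comm (volume _), ENNReal.mul_inv_cancel hb0 hbt, mul_one,
      mul_comm]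
  rw [heq]
  exact mul_le_mul_right (lintegral_mono_set Metric.ball_subset_closedBall) _

/-- Small radii are controlled by the limit at `x`. For r ≥ δ, |f| ≤ |f|^p + 1 bounds the mean, the
ball having at least the volume of the δ-ball. -/
theorem exists_meanOscillation_le {E : Type*} [NormedAddCommGroup E] {f : V → E} {x : V}
    {p : ℝ≥0∞} (hp : 1 ≤ p) (hp' : p ≠ ∞) (hf : MemLp f p)
    (hx : Tendsto (meanOscillation f x) (𝓝[>] 0) (𝓝 0)) :
    ∃ M : ℝ≥0∞, M ≠ ∞ ∧ ∀ r, 0 < r → meanOscillation f x r ≤ M := by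
  obtain ⟨δ, hδ, hsmall⟩ : ∃ δ > 0, ∀ r, 0 < r → r < δ → meanOscillation f x r ≤ 1 := by
    have h := hx.eventually (eventually_le_nhds (show (0 : ℝ≥0∞) < 1 from zero_lt_one))
    obtain ⟨δ, hδ, hsub⟩ := mem_nhdsGT_iff_exists_Ioo_subset.1 h
    exact ⟨δ, hδ, fun r h0 h1 => hsub ⟨h0, h1⟩⟩
  have hp0 : p ≠ 0 := (zero_lt_one.trans_le hp).ne'
  have hp1 : 1 ≤ p.toReal := by
    rw [← ENNReal.toReal_one]; exact ENNReal.toReal_mono hp' hp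
  set I := ∫⁻ y, ‖f y‖ₑ ^ p.toReal with hI
  have hIfin : I ≠ ∞ := ((eLpNorm_lt_top_iff_lintegral_rpow_enorm_lt_top hp0 hp').1 hf.2).ne
  have hv : volume (Metric.closedBall x δ) ≠ 0 := (Metric.measure_closedBall_pos _ _ hδ).ne'
  refine ⟨1 + (1 + ‖f x‖ₑ + I / volume (Metric.closedBall x δ)), ?_, fun r hr => ?_⟩
  · simp [ENNReal.add_eq_top, ENNReal.div_eq_top, hIfin, hv]
  rcases lt_or_ge r δ with hrδ | hrδ
  · exact (hsmall r hr hrδ).trans le_self_add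
  refine le_trans ?_ le_add_self
  have hB0 : volume (Metric.closedBall x r) ≠ 0 := (Metric.measure_closedBall_pos _ _ hr).ne'
  have hBt : volume (Metric.closedBall x r) ≠ ∞ := measure_closedBall_lt_top.ne
  have hpt : ∀ y, ‖f y - f x‖ₑ ≤ ‖f y‖ₑ ^ p.toReal + (1 + ‖f x‖ₑ) := by
    intro y
    refine (enorm_sub_le).trans ?_
    rw [← add_assoc]
    gcongr
    rcases le_total ‖f y‖ₑ 1 with h | h
    · exact h.trans le_add_self
    · refine le_trans ?_ le_self_add
      exact ENNReal.le_rpow_self_of_one_le h hp1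
  have hint : ∫⁻ y in Metric.closedBall x r, ‖f y - f x‖ₑ ≤
      I + (1 + ‖f x‖ₑ) * volume (Metric.closedBall x r) := by
    refine (lintegral_mono hpt).trans ?_
    rw [lintegral_add_right _ measurable_const, setLIntegral_const]
    gcongr
    exact setLIntegral_le_lintegral _ _
  refine (ENNReal.div_le_div_right hint _).trans ?_
  rw [ENNReal.add_div, ENNReal.mul_div_cancel_right hB0 hBt, add_comm]
  gcongr

/-- By the layer-cake formula the integral is one over levels `l` of integrals over balls. Each
tends to 0 by `hx`, and M · vol{k > l} dominates, with integral M ∫ k. -/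
theorem tendsto_lintegral_oscillation [Nontrivial V] {E : Type*} [NormedAddCommGroup E]
    {k : V → ℝ} (hk : RadiallyDecreasing k) (hc : Continuous k) (hi : Integrable k) {f : V → E}
    {x : V} {p : ℝ≥0∞} (hp : 1 ≤ p) (hp' : p ≠ ∞) (hf : MemLp f p)
    (hx : Tendsto (meanOscillation f x) (𝓝[>] 0) (𝓝 0)) :
    Tendsto (fun r : ℝ => ∫⁻ w, ENNReal.ofReal (k w) * ‖f (x - r • w) - f x‖ₑ)
      (𝓝[>] 0) (𝓝 0) := by
  obtain ⟨M, hM, hle⟩ := exists_meanOscillation_le hp hp' hf hx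
  choose! ρ hρ using fun (l : ℝ) (hl : 0 < l) => hk.superlevel_eq_ball hc hi hl
  let F : ℝ → ℝ → ℝ≥0∞ := fun r l => ∫⁻ w in {z | l < k z}, ‖f (x - r • w) - f x‖ₑ
  have hlayer : ∀ r, 0 < r → ∫⁻ w, ENNReal.ofReal (k w) * ‖f (x - r • w) - f x‖ₑ =
      ∫⁻ l in Set.Ioi 0, F r l := by
    intro r hr
    have hq : Measure.QuasiMeasurePreserving (fun w : V => x - r • w) volume volume := by
      refine (Measure.measurePreserving_sub_left (volume : Measure V)
        x).quasiMeasurePreserving.comp ⟨by fun_prop, ?_⟩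
      rw [Measure.map_addHaar_smul _ hr.ne']
      exact Measure.smul_absolutelyContinuous
    have hm : AEMeasurable (fun w : V => ‖f (x - r • w) - f x‖ₑ) :=
      ((hf.1.comp_quasiMeasurePreserving hq).sub aestronglyMeasurable_const).enorm
    let μ : Measure V := volume.withDensity fun w => ‖f (x - r • w) - f x‖ₑ
    have h1 := lintegral_eq_lintegral_meas_lt μ (ae_of_all _ hk.nonneg)
      hc.measurable.aemeasurable
    rw [lintegral_withDensity_eq_lintegral_mul₀ hm
      hc.measurable.ennreal_ofReal.aemeasurable] at h1
    simp only [Pi.mul_apply, mul_comm] at h1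
    simp only [F]
    rw [h1]
    congr 1
    ext l
    exact withDensity_apply _ (isOpen_lt continuous_const hc).measurableSet
  -- Superlevel sets shrink as `l` grows, so `F r` is antitone.
  have hFm : ∀ r, Measurable (F r) := fun r =>
    Antitone.measurable fun a b hab => lintegral_mono_set fun z hz => lt_of_le_of_lt hab hz
  have hFle : ∀ r, 0 < r → ∀ l, 0 < l → 0 < ρ l →
      F r l ≤ volume {z | l < k z} * meanOscillation f x (r * ρ l) := by
    intro r hr l hl hρl
    simp only [F]
    rw [hρ l hl]
    exact lintegral_ball_rescale_le f x hr hρl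
  have hF0 : ∀ r l, 0 < l → ρ l ≤ 0 → F r l = 0 := by
    intro r l hl hρl
    simp only [F]
    rw [hρ l hl, Metric.ball_eq_empty.2 hρl]
    simp
  have hvol : ∫⁻ l in Set.Ioi 0, volume {z | l < k z} ≠ ∞ := by
    rw [← lintegral_eq_lintegral_meas_lt volume (ae_of_all _ hk.nonneg)
      hc.measurable.aemeasurable]
    exact hi.lintegral_lt_top.ne
  have hlim : Tendsto (fun r => ∫⁻ l in Set.Ioi 0, F r l) (𝓝[>] 0)
      (𝓝 (∫⁻ l in Set.Ioi (0 : ℝ), 0)) := by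
    refine tendsto_lintegral_filter_of_dominated_convergence
      (fun l => volume {z | l < k z} * M) (Eventually.of_forall hFm) ?_ ?_ ?_
    · filter_upwards [self_mem_nhdsWithin] with r hr
      filter_upwards [ae_restrict_mem measurableSet_Ioi] with l hl
      rcases le_or_gt (ρ l) 0 with h | h
      · rw [hF0 r l hl h]; exact zero_le
      · exact (hFle r hr l hl h).trans (mul_le_mul_right (hle _ (mul_pos hr h)) _)
    · rw [lintegral_mul_const' _ _ hM]
      exact ENNReal.mul_ne_top hvol hM
    · filter_upwards [ae_restrict_mem measurableSet_Ioi] with l hl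
      rcases le_or_gt (ρ l) 0 with h | h
      · simp only [hF0 _ l hl h, tendsto_const_nhds]
      have hr : Tendsto (fun r : ℝ => r * ρ l) (𝓝[>] 0) (𝓝[>] 0) := by
        refine tendsto_nhdsWithin_iff.2 ⟨?_, ?_⟩
        · have : Tendsto (fun r : ℝ => r * ρ l) (𝓝 0) (𝓝 (0 * ρ l)) := tendsto_id.mul_const _
          rw [zero_mul] at this
          exact this.mono_left nhdsWithin_le_nhds
        · filter_upwards [self_mem_nhdsWithin] with r hr using mul_pos hr h
      have hup := ENNReal.Tendsto.const_mul (a := volume {z | l < k z}) (hx.comp hr)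
        (Or.inr (hi.measure_gt_lt_top hl).ne)
      rw [mul_zero] at hup
      refine tendsto_of_tendsto_of_tendsto_of_le_of_le' tendsto_const_nhds hup
        (Eventually.of_forall fun _ => zero_le) ?_
      filter_upwards [self_mem_nhdsWithin] with r hr using hFle r hr l hl h
  rw [lintegral_zero] at hlim
  refine hlim.congr' ?_
  filter_upwards [self_mem_nhdsWithin] with r hr using (hlayer r hr).symm

theorem ae_tendsto_meanOscillation {E : Type*} [NormedAddCommGroup E] {f : V → E}
    {p : ℝ≥0∞} (hp : 1 ≤ p) (hf : MemLp f p) :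
    ∀ᵐ x, Tendsto (meanOscillation f x) (𝓝[>] 0) (𝓝 0) := by
  filter_upwards [(Besicovitch.vitaliFamily (volume : Measure V)).ae_tendsto_lintegral_enorm_sub_div
    (hf.locallyIntegrable hp)] with x hx
  exact hx.comp (Besicovitch.tendsto_filterAt _ x)

end ApproximateIdentity

/-! ### Limits as t → 0⁺ -/

section Semigroup

variable {𝕜 : Type*} [RCLike 𝕜] {d : ℕ} [NeZero d] {α : ℝ} {p : ℝ≥0∞}

theorem stableSemigroup_eq_integral_rescale (hα₀ : 0 < α) {t : ℝ} (ht : 0 < t)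
    (f : EuclideanSpace ℝ (Fin d) → 𝕜) (x : EuclideanSpace ℝ (Fin d)) :
    stableSemigroup α t f x = ∫ w, stableKernel d α 1 w • f (x - t ^ (1 / α) • w) := by
  set r := t ^ (1 / α) with hr
  have hr0 : 0 < r := Real.rpow_pos_of_pos ht _
  have hri : t ^ (-1 / α) = r⁻¹ := by rw [neg_div, Real.rpow_neg ht.le]
  have h := Measure.integral_comp_inv_smul_of_nonneg
    (volume : Measure (EuclideanSpace ℝ (Fin d)))
    (fun w => stableKernel d α 1 w • f (x - r • w)) hr0.le
  rw [finrank_euclideanSpace_fin, ← inv_smul_eq_iff₀ (by positivity), ← integral_smul] at h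
  rw [← h, stableSemigroup_apply]
  congr 1
  ext z
  rw [stableKernel_scaling hα₀ ht, hri, smul_inv_smul₀ hr0.ne', mul_smul, inv_pow]

/-- As the kernel has mass one, P_t f(x) - f(x) is the integral of the unit-time kernel against the
oscillation of f at scale t^{1/α}. -/
theorem tendsto_stableSemigroup (hα₀ : 0 < α) (hα₂ : α < 2) (hp : 1 ≤ p) (hp' : p ≠ ∞)
    {f : EuclideanSpace ℝ (Fin d) → 𝕜} (hf : MemLp f p) {x : EuclideanSpace ℝ (Fin d)}
    (hx : Tendsto (meanOscillation f x) (𝓝[>] 0) (𝓝 0)) :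
    Tendsto (fun t => stableSemigroup α t f x) (𝓝[>] 0) (𝓝 (f x)) := by
  have hR := radiallyDecreasing_stableKernel (d := d) hα₀ hα₂ one_pos
  have hi := integrable_stableKernel (d := d) hα₀ hα₂ one_pos
  have hr : Tendsto (fun t : ℝ => t ^ (1 / α)) (𝓝[>] 0) (𝓝[>] 0) := by
    refine tendsto_nhdsWithin_iff.2 ⟨?_, ?_⟩
    · have h1 : Tendsto (fun t : ℝ => t ^ (1 / α)) (𝓝 0) (𝓝 (0 ^ (1 / α))) :=
        (Real.continuousAt_rpow_const _ _ (Or.inr (by positivity))).tendsto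
      rw [Real.zero_rpow (by positivity)] at h1
      exact h1.mono_left nhdsWithin_le_nhds
    · filter_upwards [self_mem_nhdsWithin] with t ht using Real.rpow_pos_of_pos ht _
  have hlim := (tendsto_lintegral_oscillation hR (continuous_stableKernel hα₀ one_pos) hi hp hp' hf
    hx).comp hr
  rw [tendsto_iff_edist_tendsto_0]
  refine tendsto_of_tendsto_of_tendsto_of_le_of_le' tendsto_const_nhds hlim
    (Eventually.of_forall fun _ => zero_le) ?_
  filter_upwards [self_mem_nhdsWithin] with t ht
  have ht0 : 0 < t := ht
  have hint : Integrable fun w => stableKernel d α 1 w • f (x - t ^ (1 / α) • w) := by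
    have h1 := integrable_stableKernel_smul hα₀ hα₂ ht0 hp hf x
    have h2 := (h1.comp_smul (R := t ^ (1 / α)) (by positivity)).smul ((t ^ (1 / α)) ^ d)
    refine h2.congr (ae_of_all _ fun w => ?_)
    have hinv : t ^ (-1 / α) * t ^ (1 / α) = 1 := by
      rw [← Real.rpow_add ht0, neg_div, neg_add_cancel, Real.rpow_zero]
    simp only [Pi.smul_apply]
    rw [stableKernel_scaling hα₀ ht0, smul_smul, smul_smul, hinv, one_smul, ← mul_assoc, ← mul_pow,
      mul_comm (t ^ (1 / α)), hinv, one_pow, one_mul]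
  have hfx : ∫ w, stableKernel d α 1 w • f x = f x := by
    rw [integral_smul_const, integral_stableKernel hα₀ hα₂ one_pos, one_smul]
  have hdiff : stableSemigroup α t f x - f x =
      ∫ w, stableKernel d α 1 w • (f (x - t ^ (1 / α) • w) - f x) := by
    simp only [smul_sub]
    rw [integral_sub hint (hi.smul_const _), hfx, stableSemigroup_eq_integral_rescale hα₀ ht0]
  rw [edist_eq_enorm_sub, hdiff]
  refine (enorm_integral_le_lintegral_enorm _).trans_eq (lintegral_congr fun w => ?_)
  rw [enorm_smul, Real.enorm_eq_ofReal (hR.nonneg w)]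

theorem tendsto_semigroupQuotient (hα₀ : 0 < α) (hα₂ : α < 2) (hp : 1 ≤ p)
    {f g : EuclideanSpace ℝ (Fin d) → 𝕜} (h : HasSemigroupLimitLp α p f g)
    {x : EuclideanSpace ℝ (Fin d)}
    (hfx : Tendsto (fun t => stableSemigroup α t f x) (𝓝[>] 0) (𝓝 (f x)))
    (hgx : Tendsto (fun t => stableSemigroup α t g x) (𝓝[>] 0) (𝓝 (g x))) :
    Tendsto (fun t => semigroupQuotient α t f x) (𝓝[>] 0) (𝓝 (g x)) := by
  have hcont : ∀ {u : EuclideanSpace ℝ (Fin d) → 𝕜}, MemLp u p → ContinuousOn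
      (fun t => stableSemigroup α t u x) (Set.Ioi 0) := fun hu t ht =>
    (continuousAt_stableSemigroup_time hα₀ hα₂ ht hp hu x).continuousWithinAt
  -- Setting φ = f(x) at 0 builds in the expected limit of P_t f(x), since the formula at t = 0 need
  -- not give it.
  let φ : ℝ → 𝕜 := fun t => if t ≤ 0 then f x else stableSemigroup α t f x
  have hφ0 : φ 0 = f x := if_pos le_rfl
  have hφ : Set.EqOn φ (fun t => stableSemigroup α t f x) (Set.Ioi 0) := fun t ht =>
    if_neg (not_le.2 ht)
  have hderiv : ∀ t ∈ Set.Ioi (0 : ℝ), HasDerivAt φ (stableSemigroup α t g x) t := by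
    intro t ht
    have ht0 : 0 < t := ht
    -- Integrating the continuous right derivative from the interior point t/2 recovers P_s f(x);
    -- differentiating that integral gives a two-sided derivative.
    have h1 : ∀ s ∈ Set.Ioi (0 : ℝ), ∫ y in (t / 2)..s, stableSemigroup α y g x =
        stableSemigroup α s f x - stableSemigroup α (t / 2) f x := by
      intro s hs
      have hsub : Set.uIcc (t / 2) s ⊆ Set.Ioi 0 := fun y hy =>
        lt_of_lt_of_le (lt_min (half_pos ht0) hs) hy.1
      refine intervalIntegral.integral_eq_sub_of_hasDeriv_right ((hcont h.1).mono hsub)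
        (fun y hy => hasDerivWithinAt_stableSemigroup hα₀ hα₂
          (hsub (Set.Ioo_subset_Icc_self hy)) hp h x) ?_
      exact ((hcont h.2.1).mono hsub).intervalIntegrable
    have hsub : Set.uIcc (t / 2) t ⊆ Set.Ioi 0 := fun y hy =>
      lt_of_lt_of_le (lt_min (half_pos ht0) ht) hy.1
    have h2 := intervalIntegral.integral_hasDerivAt_right
      ((hcont h.2.1).mono hsub).intervalIntegrable
      ((hcont h.2.1).stronglyMeasurableAtFilter isOpen_Ioi t ht)
      (continuousAt_stableSemigroup_time hα₀ hα₂ ht hp h.2.1 x)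
    refine (h2.add_const (stableSemigroup α (t / 2) f x)).congr_of_eventuallyEq ?_
    filter_upwards [Ioi_mem_nhds ht0] with s hs
    rw [h1 s hs, sub_add_cancel, hφ hs]
  have hφderiv : HasDerivWithinAt φ (g x) (Set.Ici 0) 0 := by
    -- φ is right continuous at 0 and its derivative P_t g(x) tends to g(x), so the one-sided
    -- derivative at 0 exists and equals g(x).
    refine hasDerivWithinAt_Ici_of_tendsto_deriv (s := Set.Ioi 0)
      (fun t ht => (hderiv t ht).differentiableAt.differentiableWithinAt) ?_ self_mem_nhdsWithin ?_
    · rw [ContinuousWithinAt, hφ0]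
      exact hfx.congr' (hφ.symm.eventuallyEq_nhdsWithin)
    · refine hgx.congr' ?_
      filter_upwards [self_mem_nhdsWithin] with t ht using (hderiv t ht).deriv.symm
  have hslope := (hasDerivWithinAt_iff_tendsto_slope' (s := Set.Ioi 0) (by simp)).1
    hφderiv.Ioi_of_Ici
  refine hslope.congr' ?_
  filter_upwards [self_mem_nhdsWithin] with t ht
  rw [slope_def_module, hφ0, hφ ht, sub_zero, semigroupQuotient]

end Semigroup

end FracLaplacian

end

theorem mainTheorem11 {𝕜 : Type*} [RCLike 𝕜] (d : ℕ) (hd : 1 ≤ d)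
    (α : ℝ) (hα₀ : 0 < α) (hα₂ : α < 2) (p : ℝ≥0∞) (hp₁ : 1 ≤ p) (hp : p ≠ ∞)
    (f : EuclideanSpace ℝ (Fin d) → 𝕜) (hf : FracLaplacian.MemDomainLp α p f) :
    (∀ᵐ x ∂(volume : Measure (EuclideanSpace ℝ (Fin d))), FracLaplacian.MemDomainAt α f x) ∧
    ∀ g : EuclideanSpace ℝ (Fin d) → 𝕜, FracLaplacian.HasSemigroupLimitLp α p f g →
      ∀ᵐ x ∂(volume : Measure (EuclideanSpace ℝ (Fin d))),
        FracLaplacian.HasSemigroupLimitAt α f x (g x) := by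
  have : NeZero d := ⟨by omega⟩
  have key : ∀ g : EuclideanSpace ℝ (Fin d) → 𝕜, FracLaplacian.HasSemigroupLimitLp α p f g →
      ∀ᵐ x ∂(volume : Measure (EuclideanSpace ℝ (Fin d))),
        FracLaplacian.HasSemigroupLimitAt α f x (g x) := by
    intro g hg
    -- The good points are the common Lebesgue points of f and g.
    filter_upwards [FracLaplacian.ae_tendsto_meanOscillation hp₁ hg.1,
      FracLaplacian.ae_tendsto_meanOscillation hp₁ hg.2.1] with x hfx hgx
    exact ⟨fun t ht => FracLaplacian.convolutionExistsAt_stableKernel hα₀ hα₂ ht hp₁ hg.1 x,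
      FracLaplacian.tendsto_semigroupQuotient hα₀ hα₂ hp₁ hg
        (FracLaplacian.tendsto_stableSemigroup hα₀ hα₂ hp₁ hp hg.1 hfx)
        (FracLaplacian.tendsto_stableSemigroup hα₀ hα₂ hp₁ hp hg.2.1 hgx)⟩
  obtain ⟨g, hg⟩ := hf
  exact ⟨(key g hg).mono fun x hx => ⟨g x, hx⟩, key⟩
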